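/- For every prime $p$ and every real $t>0$ let $a_{pt}$ be a complex number, and let $\sigma$ be a real number, such that, as $t\to\infty$, $$\sup_p|a_{pt}|\to 0\qquad\text{and}\qquad \sum_p|a_{pt}|^2\to\sigma^2 .$$ Suppose that there are positive real numbers $(m_t)$ with $\log m_t/\log t\to 0$ and $$\sum_{p>m_t}|a_{pt}|^2\Bigl(1+\frac pt\Bigr)\longrightarrow 0\qquad(t\to\infty).$$ Let $\omega$ be a random variable uniformly distributed on $(0,1)$. Then for all sufficiently large $t$ the series $\sum_p a_{pt}p^{-i\omega t}$ over all primes converges unconditionally in $L^2$, and, as $t\to\infty$, $$\sum_{p}a_{pt}\,p^{-i\omega t}\ \longrightarrow\ \sigma Y\quad\text{in law},$$ where $Y$ is a standard complex normal variable, i.e. $Y=\frac1{\sqrt2}(N_1+iN_2)$ with $N_1,N_2$ independent real standard normal variables. (The sum of the series may equally be understood as any limit in probability, for instance an almost sure limit, of the partial sums over $p\le N$ as $N\to\infty$.) -/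

import Mathlib

open MeasureTheory ProbabilityTheory Filter Topology
open scoped ENNReal

/-- A complex random variable `Y` is standard complex normal if `Y = (N₁ + i N₂) / √2` with
`N₁`, `N₂` independent real standard normal variables. -/
def IsStdComplexNormal {Ω : Type*} [MeasurableSpace Ω] (Y : Ω → ℂ) (P : Measure Ω) : Prop :=
  ∃ N₁ N₂ : Ω → ℝ, HasLaw N₁ (gaussianReal 0 1) P ∧ HasLaw N₂ (gaussianReal 0 1) P ∧
    IndepFun N₁ N₂ P ∧
    ∀ x, Y x = ((1 / Real.sqrt 2 : ℝ) : ℂ) * ((N₁ x : ℂ) + Complex.I * (N₂ x : ℂ))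

/-- The finite sum `∑_{p ∈ s} a_{pt} p^{-i u t}` over a finite set `s` of primes. -/
noncomputable def primeSum (a : Nat.Primes → ℝ → ℂ) (s : Finset Nat.Primes) (t u : ℝ) : ℂ :=
  ∑ p ∈ s, a p t * ((p : ℕ) : ℂ) ^ (-(Complex.I * (u : ℂ) * (t : ℂ)))

/-- The finite set of all primes `p ≤ N`. -/
def primesUpTo (N : ℕ) : Finset Nat.Primes :=
  Finset.subtype Nat.Prime (Finset.range (N + 1))

/-! Split the sum at `m t`. Beyond it, the mean square over `u ∈ (0, 1)` is at most a constant times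
`∑ |a_p|² (1 + p/t)` (`setIntegral_norm_sq_primeSum_le`). This makes the tail negligible and also
gives unconditional `L²` convergence.

The head only involves primes up to `M = t ^ o(1)`, and there the phases `-u t log p` imitate
independent uniform angles. A nonzero integer combination of the `log p` with total weight at most
`K` is at least `M ^ (-K)` in absolute value, by unique factorization, so the corresponding torus
character has mean at most `2 M ^ K / t` instead of `0`
(`norm_integral_torusChar_logAngleLaw_sub_le`). Moments up to order `K` therefore nearly agree with
those of the independent model. Taylor expansion to an even order `K` carries this over to
characteristic functions, the remainder being controlled by the `K`-th moment of the model
(`norm_integral_cexp_reTrigSum_sub_le`).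

In the model the characteristic function is a product whose factors are `exp (-|b|²/4) + O(|b|³)`.
As the coefficients are uniformly small, the product tends to `exp (-σ² |z|²/4)`, the characteristic
function of `σ Y`. Lévy's continuity theorem settles the head and Slutsky's lemma restores the tail.
-/

/-! ### Mean-square bound for sums over primes -/

theorem integral_exp_neg_sq_mul_cexp (y : ℝ) :
    ∫ u : ℝ, ((Real.exp (1 - u ^ 2) : ℝ) : ℂ) * Complex.exp (-(Complex.I * u * y)) =
      ((Real.exp 1 * √Real.pi * Real.exp (-(y ^ 2 / 4)) : ℝ) : ℂ) := by
  have h := fourierIntegral_gaussian (b := 1) (by simp) (-(y : ℂ))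
  have hpi : ((Real.pi : ℂ) / 1) ^ (1 / 2 : ℂ) = ((√Real.pi : ℝ) : ℂ) := by
    rw [div_one, Real.sqrt_eq_rpow, Complex.ofReal_cpow Real.pi_pos.le]
    norm_num
  rw [hpi] at h
  have h2 : ∀ u : ℝ, ((Real.exp (1 - u ^ 2) : ℝ) : ℂ) * Complex.exp (-(Complex.I * u * y)) =
      (Real.exp 1 : ℂ) * (Complex.exp (Complex.I * (-(y : ℂ)) * u) *
        Complex.exp (-1 * (u : ℂ) ^ 2)) := by
    intro u
    rw [Complex.ofReal_exp, Complex.ofReal_exp, ← Complex.exp_add, ← Complex.exp_add,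
      ← Complex.exp_add]
    congr 1
    push_cast
    ring
  simp_rw [h2]
  rw [integral_const_mul, h]
  push_cast
  rw [mul_assoc]
  congr 3
  ring

theorem integrable_exp_neg_sq_mul_cexp (y : ℝ) :
    Integrable fun u : ℝ => ((Real.exp (1 - u ^ 2) : ℝ) : ℂ) *
      Complex.exp (-(Complex.I * u * y)) := by
  have h : Integrable fun u : ℝ => Real.exp (1 - u ^ 2) := by
    have := (integrable_exp_neg_mul_sq (b := 1) one_pos).const_mul (Real.exp 1)
    refine this.congr (ae_of_all _ fun u => ?_)
    simp only [← Real.exp_add]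
    congr 1
    ring
  refine h.ofReal.mul_bdd (c := 1) (by fun_prop) (ae_of_all _ fun u => ?_)
  rw [Complex.norm_exp]
  simp

/-- This is `(|y|/2 - 1)² ≥ 0`. At `y = t log m - t log n` the weaker decay becomes a power of
`m/n`, which can be summed by hand. -/
theorem exp_neg_sq_div_four_le (y : ℝ) :
    Real.exp (-(y ^ 2 / 4)) ≤ Real.exp 1 * Real.exp (-|y|) := by
  rw [← Real.exp_add]
  apply Real.exp_le_exp.mpr
  nlinarith [sq_nonneg (|y| / 2 - 1), sq_abs y]

/-- The weight `exp (1 - u²)` is at least `1` on `(0, 1)` and positive everywhere, so it majorizes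
the indicator. Expanding the square against it leaves Gaussian Fourier transforms at the differences
`x i - x j`. -/
theorem setIntegral_norm_sq_exp_sum_le {ι : Type*} (s : Finset ι) (c : ι → ℂ) (x : ι → ℝ) :
    ∫ u in Set.Ioo (0 : ℝ) 1, ‖∑ i ∈ s, c i * Complex.exp (-(Complex.I * u * x i))‖ ^ 2 ≤
      Real.exp 2 * √Real.pi *
        ∑ i ∈ s, ∑ j ∈ s, ‖c i‖ * ‖c j‖ * Real.exp (-|x i - x j|) := by
  set S : ℝ → ℂ := fun u => ∑ i ∈ s, c i * Complex.exp (-(Complex.I * u * x i)) with hS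
  have hexpand : ∀ u : ℝ, ((Real.exp (1 - u ^ 2) * ‖S u‖ ^ 2 : ℝ) : ℂ) =
      ∑ i ∈ s, ∑ j ∈ s, (c i * (starRingEnd ℂ) (c j)) *
        (((Real.exp (1 - u ^ 2) : ℝ) : ℂ) *
          Complex.exp (-(Complex.I * u * ((x i - x j : ℝ) : ℂ)))) := by
    intro u
    rw [Complex.ofReal_mul, Complex.ofReal_pow, ← Complex.mul_conj', hS]
    simp only [map_sum, Finset.sum_mul_sum]
    rw [Finset.mul_sum]
    refine Finset.sum_congr rfl fun i _ => ?_
    rw [Finset.mul_sum]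
    refine Finset.sum_congr rfl fun j _ => ?_
    rw [map_mul, ← Complex.exp_conj]
    have : Complex.exp (-(Complex.I * u * ((x i - x j : ℝ) : ℂ))) =
        Complex.exp (-(Complex.I * u * x i)) *
          Complex.exp ((starRingEnd ℂ) (-(Complex.I * u * x j))) := by
      rw [← Complex.exp_add]
      congr 1
      simp
      ring
    rw [this]
    ring
  have hint : Integrable fun u : ℝ => Real.exp (1 - u ^ 2) * ‖S u‖ ^ 2 := by
    have : Integrable fun u : ℝ => ((Real.exp (1 - u ^ 2) * ‖S u‖ ^ 2 : ℝ) : ℂ) := by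
      simp_rw [hexpand]
      exact integrable_finsetSum _ fun i _ => integrable_finsetSum _ fun j _ =>
        (integrable_exp_neg_sq_mul_cexp _).const_mul _
    have h := this.re
    simp only [RCLike.re_eq_complex_re, Complex.ofReal_re] at h
    exact h
  have hcont : Continuous fun u : ℝ => ‖S u‖ ^ 2 := by
    simp only [hS]
    fun_prop
  have h1 : ∫ u in Set.Ioo (0 : ℝ) 1, ‖S u‖ ^ 2 ≤ ∫ u, Real.exp (1 - u ^ 2) * ‖S u‖ ^ 2 := by
    refine le_trans (setIntegral_mono_on
      ((hcont.integrableOn_Icc (a := 0) (b := 1)).mono_set Set.Ioo_subset_Icc_self)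
      hint.integrableOn measurableSet_Ioo fun u hu => ?_)
      (setIntegral_le_integral hint (ae_of_all _ fun u => by positivity))
    have : 1 ≤ Real.exp (1 - u ^ 2) := Real.one_le_exp (by nlinarith [hu.1, hu.2])
    nlinarith [sq_nonneg ‖S u‖]
  refine h1.trans ?_
  have h2 : ((∫ u, Real.exp (1 - u ^ 2) * ‖S u‖ ^ 2 : ℝ) : ℂ) =
      ∑ i ∈ s, ∑ j ∈ s, (c i * (starRingEnd ℂ) (c j)) *
        ((Real.exp 1 * √Real.pi * Real.exp (-((x i - x j) ^ 2 / 4)) : ℝ) : ℂ) := by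
    rw [← integral_complex_ofReal]
    simp_rw [hexpand]
    rw [integral_finsetSum _ fun i _ => integrable_finsetSum _ fun j _ =>
        (integrable_exp_neg_sq_mul_cexp _).const_mul _]
    refine Finset.sum_congr rfl fun i _ => ?_
    rw [integral_finsetSum _ fun j _ => (integrable_exp_neg_sq_mul_cexp _).const_mul _]
    refine Finset.sum_congr rfl fun j _ => ?_
    rw [integral_const_mul, integral_exp_neg_sq_mul_cexp]
  have h3 : ∫ u, Real.exp (1 - u ^ 2) * ‖S u‖ ^ 2 ≤
      ‖((∫ u, Real.exp (1 - u ^ 2) * ‖S u‖ ^ 2 : ℝ) : ℂ)‖ := by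
    rw [Complex.norm_real]
    exact le_abs_self _
  refine h3.trans ?_
  rw [h2, Finset.mul_sum]
  refine norm_sum_le_of_le _ fun i _ => ?_
  rw [Finset.mul_sum]
  refine norm_sum_le_of_le _ fun j _ => ?_
  rw [norm_mul, norm_mul, Complex.norm_real, RCLike.norm_conj, Real.norm_of_nonneg (by positivity)]
  have h4 := exp_neg_sq_div_four_le (x i - x j)
  have h5 : Real.exp 2 = Real.exp 1 * Real.exp 1 := by rw [← Real.exp_add]; norm_num
  calc ‖c i‖ * ‖c j‖ * (Real.exp 1 * √Real.pi * Real.exp (-((x i - x j) ^ 2 / 4)))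
      ≤ ‖c i‖ * ‖c j‖ * (Real.exp 1 * √Real.pi * (Real.exp 1 * Real.exp (-|x i - x j|))) := by
        gcongr
    _ = _ := by rw [h5]; ring

/-- A discrete `∫ x ^ t`: the inductive step is Bernoulli's inequality for `(1 + 1/k) ^ (t + 1)`. -/
theorem sum_range_rpow_le {t : ℝ} (ht : 0 < t) (k : ℕ) :
    (t + 1) * ∑ n ∈ Finset.range k, (n : ℝ) ^ t ≤ (k : ℝ) ^ (t + 1) := by
  induction k with
  | zero => simp [Real.zero_rpow (by positivity : t + 1 ≠ 0)]
  | succ k ih =>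
    rw [Finset.sum_range_succ, mul_add]
    rcases Nat.eq_zero_or_pos k with rfl | hk
    · simp [Real.zero_rpow ht.ne']
    have hk' : (0 : ℝ) < k := by exact_mod_cast hk
    have hb := one_add_mul_self_le_rpow_one_add (s := 1 / (k : ℝ)) (p := t + 1)
      (by have : 0 < 1 / (k : ℝ) := by positivity
          linarith) (by linarith)
    have h1 : ((k + 1 : ℕ) : ℝ) ^ (t + 1) = (k : ℝ) ^ (t + 1) * (1 + 1 / (k : ℝ)) ^ (t + 1) := by
      rw [← Real.mul_rpow hk'.le (by positivity)]
      congr 1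
      push_cast
      field_simp
    have h2 : (k : ℝ) ^ (t + 1) = (k : ℝ) ^ t * k := by
      rw [Real.rpow_add hk', Real.rpow_one]
    have h3 : (k : ℝ) ^ (t + 1) * (1 + (t + 1) * (1 / (k : ℝ))) =
        (k : ℝ) ^ (t + 1) + (t + 1) * (k : ℝ) ^ t := by
      rw [h2]
      field_simp
    rw [h1]
    have := mul_le_mul_of_nonneg_left hb (by positivity : 0 ≤ (k : ℝ) ^ (t + 1))
    linarith

/-- A discrete `∫ x ^ (-t)`. The exponent `1 - t` is nonpositive, and the Bernoulli-type inequality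
needed here comes from `log (1 - x) ≤ -x` and `1 + y ≤ exp y`. -/
theorem sum_Ioc_rpow_neg_le {t : ℝ} (ht : 1 ≤ t) {m M : ℕ} (hm : 0 < m) (hM : m ≤ M) :
    (t - 1) * ∑ n ∈ Finset.Ioc m M, (n : ℝ) ^ (-t) ≤
      (m : ℝ) ^ (1 - t) - (M : ℝ) ^ (1 - t) := by
  induction M, hM using Nat.le_induction with
  | base => simp
  | succ M hM ih =>
    rw [Finset.sum_Ioc_succ_top (by omega), mul_add]
    have hM' : (0 : ℝ) < M := by exact_mod_cast hm.trans_le hM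
    set N : ℝ := ((M + 1 : ℕ) : ℝ) with hN
    have hNM : (M : ℝ) = N - 1 := by simp [hN]
    have hN0 : 0 < N := by rw [hN]; positivity
    have h1 : (M : ℝ) ^ (1 - t) = N ^ (1 - t) * (1 - 1 / N) ^ (1 - t) := by
      have hnn : 0 ≤ 1 - 1 / N := by
        rw [sub_nonneg, div_le_one hN0]; linarith
      rw [← Real.mul_rpow hN0.le hnn, hNM]
      congr 1
      field_simp
    have h2 : 1 + (t - 1) * (1 / N) ≤ (1 - 1 / N) ^ (1 - t) := by
      have hpos : 0 < 1 - 1 / N := by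
        rw [sub_pos, div_lt_one hN0]; linarith
      rw [Real.rpow_def_of_pos hpos]
      have hl : Real.log (1 - 1 / N) ≤ -(1 / N) := by
        have := Real.log_le_sub_one_of_pos hpos
        linarith
      have := Real.add_one_le_exp (Real.log (1 - 1 / N) * (1 - t))
      nlinarith
    have h3 : N ^ (1 - t) = N ^ (-t) * N := by
      rw [sub_eq_neg_add, Real.rpow_add hN0, Real.rpow_one]
    have h4 : N ^ (1 - t) * (1 + (t - 1) * (1 / N)) = N ^ (1 - t) + (t - 1) * N ^ (-t) := by
      rw [h3]
      field_simp
    have := mul_le_mul_of_nonneg_left h2 (by positivity : 0 ≤ N ^ (1 - t))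
    rw [h1] at ih
    linarith

/-- The summand is `(n/m) ^ t` below `m` and `(m/n) ^ t` above it. The two ranges contribute at most
`m/t` and `2m/t`, the diagonal `1`. Primality plays no role. -/
theorem sum_exp_neg_abs_log_le {t : ℝ} (ht : 2 ≤ t) (s : Finset ℕ) (hs : ∀ n ∈ s, 0 < n) {m : ℕ}
    (hm : 0 < m) :
    ∑ n ∈ s, Real.exp (-|t * Real.log m - t * Real.log n|) ≤ 4 * (1 + m / t) := by
  have hm' : (0 : ℝ) < m := by exact_mod_cast hm
  set f : ℕ → ℝ := fun n => Real.exp (-|t * Real.log m - t * Real.log n|) with hf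
  set M := m + s.sup id with hM
  have hsub : s ⊆ (Finset.Ico 1 m ∪ {m}) ∪ Finset.Ioc m M := by
    intro n hn
    have h1 := hs n hn
    have h2 : n ≤ s.sup id := Finset.le_sup (f := id) hn
    simp only [Finset.mem_union, Finset.mem_Ico, Finset.mem_singleton, Finset.mem_Ioc]
    omega
  have hpos : ∀ n, 0 ≤ f n := fun n => (Real.exp_pos _).le
  have hle := Finset.sum_le_sum_of_subset_of_nonneg hsub fun n _ _ => hpos n
  have hun : ∀ A B : Finset ℕ, ∑ n ∈ A ∪ B, f n ≤ ∑ n ∈ A, f n + ∑ n ∈ B, f n := by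
    intro A B
    have := Finset.sum_union_inter (s₁ := A) (s₂ := B) (f := f)
    have h0 : 0 ≤ ∑ n ∈ A ∩ B, f n := Finset.sum_nonneg fun n _ => hpos n
    linarith
  have h1 : ∑ n ∈ Finset.Ico 1 m, f n ≤ m / t := by
    have hle : ∀ n ∈ Finset.Ico 1 m, f n = (m : ℝ) ^ (-t) * (n : ℝ) ^ t := by
      intro n hn
      rw [Finset.mem_Ico] at hn
      have hn0 : (0 : ℝ) < n := by exact_mod_cast hn.1
      have hlog : Real.log n ≤ Real.log m :=
        Real.log_le_log hn0 (by exact_mod_cast hn.2.le)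
      rw [Real.rpow_def_of_pos hm', Real.rpow_def_of_pos hn0, ← Real.exp_add, hf]
      simp only
      rw [abs_of_nonneg (by nlinarith)]
      congr 1
      ring
    rw [Finset.sum_congr rfl hle, ← Finset.mul_sum]
    have h2 : ∑ n ∈ Finset.Ico 1 m, (n : ℝ) ^ t ≤ ∑ n ∈ Finset.range m, (n : ℝ) ^ t :=
      Finset.sum_le_sum_of_subset_of_nonneg
        (by intro n hn; rw [Finset.mem_Ico] at hn; exact Finset.mem_range.mpr hn.2)
        fun n _ _ => by positivity
    have h3 := sum_range_rpow_le (t := t) (by linarith) m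
    have h4 : (t + 1) * ∑ n ∈ Finset.Ico 1 m, (n : ℝ) ^ t ≤ (m : ℝ) ^ (t + 1) := by nlinarith
    have h0 : 0 ≤ ∑ n ∈ Finset.Ico 1 m, (n : ℝ) ^ t :=
      Finset.sum_nonneg fun n _ => by positivity
    rw [le_div_iff₀ (by linarith)]
    have h5 : (m : ℝ) ^ (-t) * (m : ℝ) ^ (t + 1) = m := by
      rw [← Real.rpow_add hm']; simp
    calc (m : ℝ) ^ (-t) * (∑ n ∈ Finset.Ico 1 m, (n : ℝ) ^ t) * t
        ≤ (m : ℝ) ^ (-t) * (m : ℝ) ^ (t + 1) := by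
          rw [mul_assoc]
          gcongr
          linarith
      _ = m := h5
  have h2 : ∑ n ∈ ({m} : Finset ℕ), f n = 1 := by simp [hf]
  have h3 : ∑ n ∈ Finset.Ioc m M, f n ≤ 2 * (m / t) := by
    have hle : ∀ n ∈ Finset.Ioc m M, f n = (m : ℝ) ^ t * (n : ℝ) ^ (-t) := by
      intro n hn
      rw [Finset.mem_Ioc] at hn
      have hn0 : (0 : ℝ) < n := by exact_mod_cast hm.trans hn.1
      have hlog : Real.log m ≤ Real.log n :=
        Real.log_le_log hm' (by exact_mod_cast hn.1.le)
      rw [Real.rpow_def_of_pos hm', Real.rpow_def_of_pos hn0, ← Real.exp_add, hf]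
      simp only
      rw [abs_of_nonpos (by nlinarith)]
      congr 1
      ring
    rw [Finset.sum_congr rfl hle, ← Finset.mul_sum]
    have h3 := sum_Ioc_rpow_neg_le (t := t) (by linarith) hm (show m ≤ M by omega)
    have h6 : (0 : ℝ) ≤ (M : ℝ) ^ (1 - t) := by positivity
    have h0 : 0 ≤ ∑ n ∈ Finset.Ioc m M, (n : ℝ) ^ (-t) :=
      Finset.sum_nonneg fun n _ => by positivity
    have h5 : (m : ℝ) ^ t * (m : ℝ) ^ (1 - t) = m := by
      rw [← Real.rpow_add hm']; simp
    -- Here `t ≥ 2` enters, as `t ≤ 2 (t - 1)`.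
    have h7 : t * ∑ n ∈ Finset.Ioc m M, (n : ℝ) ^ (-t) ≤ 2 * (m : ℝ) ^ (1 - t) := by nlinarith
    rw [← mul_div_assoc, le_div_iff₀ (by linarith)]
    calc (m : ℝ) ^ t * (∑ n ∈ Finset.Ioc m M, (n : ℝ) ^ (-t)) * t
        = (m : ℝ) ^ t * (t * ∑ n ∈ Finset.Ioc m M, (n : ℝ) ^ (-t)) := by ring
      _ ≤ (m : ℝ) ^ t * (2 * (m : ℝ) ^ (1 - t)) := mul_le_mul_of_nonneg_left h7 (by positivity)
      _ = 2 * m := by rw [mul_left_comm, h5]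
  have h4 : (0 : ℝ) ≤ m / t := by positivity
  have := hun (Finset.Ico 1 m ∪ {m}) (Finset.Ioc m M)
  have := hun (Finset.Ico 1 m) {m}
  linarith

/-- Schur's test for a symmetric kernel. -/
theorem sum_sum_mul_mul_le_of_symm {ι : Type*} (s : Finset ι) (r : ι → ℝ) (K : ι → ι → ℝ)
    (hK : ∀ i j, 0 ≤ K i j) (hsymm : ∀ i j, K i j = K j i) :
    ∑ i ∈ s, ∑ j ∈ s, r i * r j * K i j ≤ ∑ i ∈ s, r i ^ 2 * ∑ j ∈ s, K i j := by
  -- The second term is written with `K j i` so that exchanging the sums turns it into the first.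
  have h1 : ∑ i ∈ s, ∑ j ∈ s, r i * r j * K i j ≤
      ∑ i ∈ s, ∑ j ∈ s, (r i ^ 2 * K i j / 2 + r j ^ 2 * K j i / 2) := by
    refine Finset.sum_le_sum fun i _ => Finset.sum_le_sum fun j _ => ?_
    rw [hsymm j i]
    nlinarith [hK i j, mul_nonneg (hK i j) (sq_nonneg (r i - r j))]
  refine h1.trans (le_of_eq ?_)
  simp_rw [Finset.sum_add_distrib]
  rw [Finset.sum_comm (f := fun i j => r j ^ 2 * K j i / 2), ← Finset.sum_add_distrib]
  refine Finset.sum_congr rfl fun i _ => ?_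
  rw [← Finset.sum_add_distrib, Finset.mul_sum]
  exact Finset.sum_congr rfl fun j _ => by ring

theorem primeSum_eq_sum_exp (a : Nat.Primes → ℝ → ℂ) (s : Finset Nat.Primes) (t u : ℝ) :
    primeSum a s t u = ∑ p ∈ s, a p t *
      Complex.exp (-(Complex.I * u * ((t * Real.log (p : ℕ) : ℝ) : ℂ))) := by
  refine Finset.sum_congr rfl fun p _ => ?_
  have hp : (((p : ℕ) : ℂ)) ≠ 0 := by exact_mod_cast p.2.ne_zero
  rw [Complex.cpow_def_of_ne_zero hp, Complex.natCast_log.symm]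
  congr 2
  push_cast
  ring

theorem continuous_primeSum (a : Nat.Primes → ℝ → ℂ) (s : Finset Nat.Primes) (t : ℝ) :
    Continuous (primeSum a s t) := by
  rw [show primeSum a s t = _ from funext (primeSum_eq_sum_exp a s t)]
  fun_prop

theorem setIntegral_norm_sq_primeSum_le (a : Nat.Primes → ℝ → ℂ) (s : Finset Nat.Primes) {t : ℝ}
    (ht : 2 ≤ t) :
    ∫ u in Set.Ioo (0 : ℝ) 1, ‖primeSum a s t u‖ ^ 2 ≤
      Real.exp 2 * √Real.pi * 4 * ∑ p ∈ s, ‖a p t‖ ^ 2 * (1 + ((p : ℕ) : ℝ) / t) := by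
  simp_rw [primeSum_eq_sum_exp]
  refine (setIntegral_norm_sq_exp_sum_le s _ _).trans ?_
  rw [mul_assoc _ (4 : ℝ), Finset.mul_sum s _ (4 : ℝ)]
  refine mul_le_mul_of_nonneg_left ?_ (by positivity)
  refine (sum_sum_mul_mul_le_of_symm s (fun p => ‖a p t‖)
    (fun p q => Real.exp (-|t * Real.log (p : ℕ) - t * Real.log (q : ℕ)|))
    (fun _ _ => (Real.exp_pos _).le) (fun p q => by rw [abs_sub_comm])).trans ?_
  refine Finset.sum_le_sum fun p _ => ?_
  rw [mul_left_comm]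
  gcongr
  have h := sum_exp_neg_abs_log_le ht (s.map ⟨fun p : Nat.Primes => (p : ℕ), Nat.Primes.coe_nat_injective⟩)
    (by simp only [Finset.mem_map]; rintro _ ⟨q, _, rfl⟩; exact q.2.pos) p.2.pos
  rwa [Finset.sum_map] at h

theorem map_eq_restrict_of_isUniform_Ioo {Ω : Type*} [MeasurableSpace Ω] {P : Measure Ω}
    {ω : Ω → ℝ} (hω : pdf.IsUniform ω (Set.Ioo (0 : ℝ) 1) P) :
    P.map ω = volume.restrict (Set.Ioo (0 : ℝ) 1) := by
  rw [hω, ProbabilityTheory.cond]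
  simp

theorem eLpNorm_primeSum_sq_le {Ω : Type*} [MeasurableSpace Ω] {P : Measure Ω}
    {ω : Ω → ℝ} (hω : pdf.IsUniform ω (Set.Ioo (0 : ℝ) 1) P)
    (a : Nat.Primes → ℝ → ℂ) (s : Finset Nat.Primes) {t : ℝ} (ht : 2 ≤ t) :
    eLpNorm (fun x => primeSum a s t (ω x)) 2 P ^ 2 ≤
      ENNReal.ofReal (Real.exp 2 * √Real.pi * 4) *
        ∑ p ∈ s, ‖a p t‖ₑ ^ 2 * ENNReal.ofReal (1 + ((p : ℕ) : ℝ) / t) := by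
  have hωm : AEMeasurable ω P := hω.aemeasurable (by simp) (by simp)
  have hc := continuous_primeSum a s t
  have h1 : eLpNorm (fun x => primeSum a s t (ω x)) 2 P ^ 2 =
      ∫⁻ u in Set.Ioo (0 : ℝ) 1, ‖primeSum a s t u‖ₑ ^ 2 := by
    rw [eLpNorm_eq_lintegral_rpow_enorm_toReal (by simp) (by simp), ← ENNReal.rpow_natCast,
      ← ENNReal.rpow_mul, ← map_eq_restrict_of_isUniform_Ioo hω,
      lintegral_map' (by fun_prop) hωm]
    simp
  rw [h1]
  have h2 : ∫⁻ u in Set.Ioo (0 : ℝ) 1, ‖primeSum a s t u‖ₑ ^ 2 =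
      ENNReal.ofReal (∫ u in Set.Ioo (0 : ℝ) 1, ‖primeSum a s t u‖ ^ 2) := by
    rw [ofReal_integral_eq_lintegral_ofReal]
    · refine lintegral_congr fun u => ?_
      rw [ENNReal.ofReal_pow (norm_nonneg _), ofReal_norm]
    · exact ((hc.norm.pow 2).integrableOn_Icc (a := 0) (b := 1)).mono_set Set.Ioo_subset_Icc_self
    · exact ae_of_all _ fun u => by positivity
  rw [h2]
  refine (ENNReal.ofReal_le_ofReal (setIntegral_norm_sq_primeSum_le a s ht)).trans (le_of_eq ?_)
  rw [ENNReal.ofReal_mul (by positivity), ENNReal.ofReal_sum_of_nonneg fun p _ => by positivity]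
  congr 1
  refine Finset.sum_congr rfl fun p _ => ?_
  rw [ENNReal.ofReal_mul (by positivity), ENNReal.ofReal_pow (norm_nonneg _), ofReal_norm]

/-! ### Taylor comparison of characteristic functions on a torus -/

/-- The remainder of order `K + 1` vanishes at `0` and its derivative is `c` times the remainder of
order `K`, so the bound integrates by induction. Taking `c = ±I` covers both signs of the real
argument. -/
theorem norm_exp_mul_sub_sum_le_of_nonneg {c : ℂ} (hc : c.re = 0) (hc1 : ‖c‖ = 1) (K : ℕ) :
    ∀ x : ℝ, 0 ≤ x → ‖Complex.exp (c * x) - ∑ k ∈ Finset.range K, (c * x) ^ k / k.factorial‖ ≤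
      x ^ K / K.factorial := by
  induction K with
  | zero =>
    intro x _
    simp [Complex.norm_exp, hc]
  | succ K ih =>
    intro x hx
    have hd : ∀ y : ℝ, HasDerivAt (fun y : ℝ => Complex.exp (c * y) -
        ∑ k ∈ Finset.range (K + 1), (c * y) ^ k / k.factorial)
        (c * (Complex.exp (c * y) - ∑ k ∈ Finset.range K, (c * y) ^ k / k.factorial)) y := by
      intro y
      have hl : HasDerivAt (fun y : ℝ => c * (y : ℂ)) c y := by
        simpa using (Complex.ofRealCLM.hasDerivAt (x := y)).const_mul c
      have hs : HasDerivAt (fun y : ℝ => ∑ k ∈ Finset.range (K + 1), (c * (y : ℂ)) ^ k / k.factorial)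
          (∑ k ∈ Finset.range (K + 1), ((k : ℂ) * (c * (y : ℂ)) ^ (k - 1) * c) / k.factorial) y :=
        HasDerivAt.fun_sum fun k _ => (hl.pow k).div_const _
      refine (hl.cexp.sub hs).congr_deriv ?_
      rw [Finset.sum_range_succ', mul_sub, Finset.mul_sum]
      simp only [Nat.cast_zero, zero_mul, zero_div, add_zero, Nat.add_sub_cancel]
      rw [mul_comm]
      congr 1
      refine Finset.sum_congr rfl fun k _ => ?_
      have hk : ((k : ℂ) + 1) ≠ 0 := by exact_mod_cast k.succ_ne_zero
      have hf : ((k.factorial : ℕ) : ℂ) ≠ 0 := by exact_mod_cast k.factorial_ne_zero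
      rw [Nat.factorial_succ]
      push_cast
      field_simp
    have hB : ∀ y : ℝ, HasDerivAt (fun y : ℝ => y ^ (K + 1) / (K + 1).factorial)
        (y ^ K / K.factorial) y := by
      intro y
      refine ((hasDerivAt_pow (K + 1) y).div_const _).congr_deriv ?_
      have hf : ((K.factorial : ℕ) : ℝ) ≠ 0 := by exact_mod_cast K.factorial_ne_zero
      have hk : ((K : ℝ) + 1) ≠ 0 := by positivity
      rw [Nat.factorial_succ]
      push_cast
      field_simp
    refine image_norm_le_of_norm_deriv_right_le_deriv_boundary (a := 0) (b := x)
      (fun y _ => (hd y).continuousAt.continuousWithinAt)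
      (fun y _ => (hd y).hasDerivWithinAt) ?_ hB ?_ ⟨hx, le_rfl⟩
    · simp [Finset.sum_range_succ']
    · intro y hy
      rw [norm_mul, hc1, one_mul]
      exact ih y hy.1

theorem norm_exp_I_mul_sub_sum_le (x : ℝ) (K : ℕ) :
    ‖Complex.exp (Complex.I * x) - ∑ k ∈ Finset.range K, (Complex.I * x) ^ k / k.factorial‖ ≤
      |x| ^ K / K.factorial := by
  rcases le_total 0 x with hx | hx
  · rw [abs_of_nonneg hx]
    exact norm_exp_mul_sub_sum_le_of_nonneg (by simp) (by simp) K x hx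
  · rw [abs_of_nonpos hx]
    have := norm_exp_mul_sub_sum_le_of_nonneg (c := -Complex.I) (by simp) (by simp) K (-x)
      (by linarith)
    simpa using this

/-- The real part of the trigonometric sum with coefficients `b` and phases `θ`. -/
noncomputable def reTrigSum {ι : Type*} [Fintype ι] (b : ι → ℂ) (θ : ι → ℝ) : ℝ :=
  ∑ i, (b i * Complex.exp (Complex.I * θ i)).re

/-- The character of the torus with frequency vector `n`. -/
noncomputable def torusChar {ι : Type*} [Fintype ι] (n : ι → ℤ) (θ : ι → ℝ) : ℂ :=
  Complex.exp (Complex.I * ((∑ i, (n i : ℝ) * θ i : ℝ) : ℂ))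

section TrigSum

variable {ι : Type*} [Fintype ι]

theorem continuous_reTrigSum (b : ι → ℂ) : Continuous (reTrigSum b) := by
  unfold reTrigSum
  fun_prop

theorem continuous_torusChar (n : ι → ℤ) : Continuous (torusChar n) := by
  unfold torusChar
  fun_prop

theorem abs_re_mul_exp_le (b : ℂ) (θ : ℝ) :
    |(b * Complex.exp (Complex.I * θ)).re| ≤ ‖b‖ := by
  refine (Complex.abs_re_le_norm _).trans ?_
  rw [norm_mul, Complex.norm_exp_I_mul_ofReal, mul_one]

theorem abs_reTrigSum_le (b : ι → ℂ) (θ : ι → ℝ) : |reTrigSum b θ| ≤ ∑ i, ‖b i‖ :=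
  (Finset.abs_sum_le_sum_abs _ _).trans (Finset.sum_le_sum fun _ _ => abs_re_mul_exp_le _ _)

theorem norm_torusChar (n : ι → ℤ) (θ : ι → ℝ) : ‖torusChar n θ‖ = 1 :=
  Complex.norm_exp_I_mul_ofReal _

theorem integrable_torusChar (μ : Measure (ι → ℝ)) [IsFiniteMeasure μ] (n : ι → ℤ) :
    Integrable (torusChar n) μ :=
  .of_bound (continuous_torusChar n).aestronglyMeasurable 1
    (ae_of_all _ fun θ => (norm_torusChar n θ).le)

theorem integrable_reTrigSum_pow (μ : Measure (ι → ℝ)) [IsFiniteMeasure μ] (b : ι → ℂ) (k : ℕ) :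
    Integrable (fun θ => reTrigSum b θ ^ k) μ := by
  refine .of_bound ((continuous_reTrigSum b).pow k).aestronglyMeasurable ((∑ i, ‖b i‖) ^ k)
    (ae_of_all _ fun θ => ?_)
  rw [norm_pow, Real.norm_eq_abs]
  exact pow_le_pow_left₀ (abs_nonneg _) (abs_reTrigSum_le b θ) k

theorem integrable_exp_reTrigSum (μ : Measure (ι → ℝ)) [IsFiniteMeasure μ] (b : ι → ℂ) :
    Integrable (fun θ => Real.exp (reTrigSum b θ)) μ := by
  refine .of_bound (Real.continuous_exp.comp (continuous_reTrigSum b)).aestronglyMeasurable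
    (Real.exp (∑ i, ‖b i‖)) (ae_of_all _ fun θ => ?_)
  rw [Real.norm_of_nonneg (Real.exp_pos _).le]
  exact Real.exp_le_exp.mpr ((le_abs_self _).trans (abs_reTrigSum_le b θ))

theorem integrable_cexp_reTrigSum (μ : Measure (ι → ℝ)) [IsFiniteMeasure μ] (b : ι → ℂ) :
    Integrable (fun θ => Complex.exp (Complex.I * reTrigSum b θ)) μ :=
  .of_bound (by have := continuous_reTrigSum b
                exact Continuous.aestronglyMeasurable (by fun_prop)) 1
    (ae_of_all _ fun θ => (Complex.norm_exp_I_mul_ofReal _).le)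

/-- The powers of a real trigonometric sum are combinations of characters of bounded degree. -/
theorem reTrigSum_pow_eq [DecidableEq ι] (b : ι → ℂ) (k : ℕ) : ∃ (c : (Fin k → ι × Bool) → ℂ)
    (n : (Fin k → ι × Bool) → ι → ℤ), (∀ θ, ((reTrigSum b θ ^ k : ℝ) : ℂ) =
      ∑ f, c f * torusChar (n f) θ) ∧ (∀ f, ∑ i, |n f i| ≤ k) ∧ ∑ f, ‖c f‖ = (∑ i, ‖b i‖) ^ k := by
  -- Write `Re w = (w + conj w) / 2`: the Boolean selects one of the two terms and `ε` is the sign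
  -- of its frequency. The two halves together have coefficient mass `‖b i‖`.
  set c₀ : ι × Bool → ℂ := fun q => if q.2 then b q.1 / 2 else (starRingEnd ℂ) (b q.1) / 2 with hc₀
  set ε : Bool → ℤ := fun e => if e then 1 else -1 with hε
  refine ⟨fun f => ∏ j, c₀ (f j), fun f i => ∑ j, if (f j).1 = i then ε (f j).2 else 0, ?_, ?_, ?_⟩
  · intro θ
    have h1 : ((reTrigSum b θ : ℝ) : ℂ) =
        ∑ q : ι × Bool, c₀ q * Complex.exp (Complex.I * ((ε q.2 : ℝ) * θ q.1 : ℝ)) := by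
      rw [Fintype.sum_prod_type, reTrigSum, Complex.ofReal_sum]
      refine Finset.sum_congr rfl fun i _ => ?_
      rw [Complex.re_eq_add_conj, map_mul, ← Complex.exp_conj]
      simp [hc₀, hε]
      ring
    rw [Complex.ofReal_pow, h1, Fintype.sum_pow]
    refine Finset.sum_congr rfl fun f _ => ?_
    rw [Finset.prod_mul_distrib, ← Complex.exp_sum, torusChar, ← Finset.mul_sum,
      ← Complex.ofReal_sum]
    congr 4
    push_cast
    simp_rw [Finset.sum_mul]
    rw [Finset.sum_comm]
    refine Finset.sum_congr rfl fun j _ => ?_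
    simp
  · intro f
    have : ∀ i, |∑ j, if (f j).1 = i then ε (f j).2 else 0| ≤ ∑ j, if (f j).1 = i then (1 : ℤ) else 0 := by
      intro i
      refine (Finset.abs_sum_le_sum_abs _ _).trans (Finset.sum_le_sum fun j _ => ?_)
      split_ifs
      · cases (f j).2 <;> simp [hε]
      · simp
    refine (Finset.sum_le_sum fun i _ => this i).trans ?_
    rw [Finset.sum_comm]
    simp
  · simp_rw [norm_prod]
    rw [← Fintype.sum_pow (fun q => ‖c₀ q‖), Fintype.sum_prod_type]
    congr 1
    refine Finset.sum_congr rfl fun i _ => ?_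
    simp [hc₀]

section Comparison

variable {μ ν : Measure (ι → ℝ)} [IsProbabilityMeasure μ] [IsProbabilityMeasure ν] {δ : ℝ} {K : ℕ}

theorem norm_integral_reTrigSum_pow_sub_le
    (h : ∀ n : ι → ℤ, ∑ i, |n i| ≤ K → ‖∫ θ, torusChar n θ ∂μ - ∫ θ, torusChar n θ ∂ν‖ ≤ δ)
    (b : ι → ℂ) {k : ℕ} (hk : k ≤ K) :
    |∫ θ, reTrigSum b θ ^ k ∂μ - ∫ θ, reTrigSum b θ ^ k ∂ν| ≤ (∑ i, ‖b i‖) ^ k * δ := by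
  classical
  obtain ⟨c, n, h1, h2, h3⟩ := reTrigSum_pow_eq b k
  have h4 : ∀ ρ : Measure (ι → ℝ), IsProbabilityMeasure ρ →
      ((∫ θ, reTrigSum b θ ^ k ∂ρ : ℝ) : ℂ) = ∑ f, c f * ∫ θ, torusChar (n f) θ ∂ρ := by
    intro ρ _
    rw [← integral_complex_ofReal]
    simp_rw [h1]
    rw [integral_finsetSum _ fun f _ => (integrable_torusChar ρ _).const_mul _]
    exact Finset.sum_congr rfl fun f _ => integral_const_mul _ _
  rw [← Real.norm_eq_abs, ← Complex.norm_real, Complex.ofReal_sub, h4 μ inferInstance,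
    h4 ν inferInstance, ← Finset.sum_sub_distrib, ← h3, Finset.sum_mul]
  refine norm_sum_le_of_le _ fun f _ => ?_
  rw [← mul_sub, norm_mul]
  gcongr
  exact h _ ((h2 f).trans (by exact_mod_cast hk))

/-- Evenness of `K` makes the absolute moment in the remainder an ordinary one, hence again a
combination of characters. -/
theorem norm_integral_cexp_sub_sum_le (μ : Measure (ι → ℝ)) [IsProbabilityMeasure μ] (b : ι → ℂ)
    (hK : Even K) :
    ‖∫ θ, Complex.exp (Complex.I * reTrigSum b θ) ∂μ -
      ∑ k ∈ Finset.range K, Complex.I ^ k / k.factorial * ((∫ θ, reTrigSum b θ ^ k ∂μ : ℝ) : ℂ)‖ ≤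
      (∫ θ, reTrigSum b θ ^ K ∂μ) / K.factorial := by
  have h1 : ∀ k, Integrable (fun θ => (Complex.I * (reTrigSum b θ : ℂ)) ^ k / k.factorial) μ := by
    intro k
    have : Integrable (fun θ => ((reTrigSum b θ ^ k : ℝ) : ℂ)) μ :=
      (integrable_reTrigSum_pow μ b k).ofReal
    refine (this.const_mul (Complex.I ^ k / k.factorial)).congr (ae_of_all _ fun θ => ?_)
    beta_reduce
    rw [mul_pow, Complex.ofReal_pow]
    ring
  have h2 : ∑ k ∈ Finset.range K, Complex.I ^ k / k.factorial *
      ((∫ θ, reTrigSum b θ ^ k ∂μ : ℝ) : ℂ) =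
      ∫ θ, ∑ k ∈ Finset.range K, (Complex.I * (reTrigSum b θ : ℂ)) ^ k / k.factorial ∂μ := by
    rw [integral_finsetSum _ fun k _ => h1 k]
    refine Finset.sum_congr rfl fun k _ => ?_
    rw [← integral_complex_ofReal, ← integral_const_mul]
    refine integral_congr_ae (ae_of_all _ fun θ => ?_)
    simp only [Complex.ofReal_pow]
    rw [mul_pow]
    ring
  rw [h2, ← integral_sub (integrable_cexp_reTrigSum μ b) (integrable_finsetSum _ fun k _ => h1 k),
    ← integral_div]
  refine norm_integral_le_of_norm_le ((integrable_reTrigSum_pow μ b K).div_const _)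
    (ae_of_all _ fun θ => ?_)
  refine (norm_exp_I_mul_sub_sum_le _ K).trans (le_of_eq ?_)
  rw [hK.pow_abs]

/-- Only moments of `ν` need a bound: the `K`-th moment under `μ` is transferred to `ν`, at the cost
of the extra `1` in `K + 1`. The factor `2` counts the two Taylor remainders. -/
theorem norm_integral_cexp_reTrigSum_sub_le
    (h : ∀ n : ι → ℤ, ∑ i, |n i| ≤ K → ‖∫ θ, torusChar n θ ∂μ - ∫ θ, torusChar n θ ∂ν‖ ≤ δ)
    (b : ι → ℂ) (hK : Even K) {B : ℝ} (hB1 : 1 ≤ B) (hB : ∑ i, ‖b i‖ ≤ B) :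
    ‖∫ θ, Complex.exp (Complex.I * reTrigSum b θ) ∂μ -
      ∫ θ, Complex.exp (Complex.I * reTrigSum b θ) ∂ν‖ ≤
      (K + 1) * (B ^ K * δ) + 2 * ((∫ θ, reTrigSum b θ ^ K ∂ν) / K.factorial) := by
  have hδ : 0 ≤ δ := (norm_nonneg _).trans (h 0 (by simp))
  have hBk : ∀ k ≤ K, (∑ i, ‖b i‖) ^ k * δ ≤ B ^ K * δ := fun k hk => by
    refine mul_le_mul_of_nonneg_right ?_ hδ
    exact (pow_le_pow_left₀ (Finset.sum_nonneg fun _ _ => norm_nonneg _) hB k).trans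
      (pow_le_pow_right₀ hB1 hk)
  have hfac : ∀ k : ℕ, (1 : ℝ) ≤ k.factorial := fun k => by exact_mod_cast k.factorial_pos
  have h1 := norm_integral_cexp_sub_sum_le μ b hK
  have h2 := norm_integral_cexp_sub_sum_le ν b hK
  have h3 : ‖∑ k ∈ Finset.range K, Complex.I ^ k / k.factorial *
        ((∫ θ, reTrigSum b θ ^ k ∂μ : ℝ) : ℂ) - ∑ k ∈ Finset.range K,
        Complex.I ^ k / k.factorial * ((∫ θ, reTrigSum b θ ^ k ∂ν : ℝ) : ℂ)‖ ≤ K * (B ^ K * δ) := by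
    rw [← Finset.sum_sub_distrib]
    have hc : (K : ℝ) * (B ^ K * δ) = ∑ _k ∈ Finset.range K, B ^ K * δ := by simp
    rw [hc]
    refine norm_sum_le_of_le _ fun k hk => ?_
    rw [← mul_sub, norm_mul, ← Complex.ofReal_sub, Complex.norm_real, norm_div, norm_pow,
      Complex.norm_I, one_pow, Complex.norm_natCast, Real.norm_eq_abs]
    have hk' := (Finset.mem_range.mp hk).le
    have h5 := norm_integral_reTrigSum_pow_sub_le h b hk'
    have h6 : 1 / (k.factorial : ℝ) ≤ 1 := by
      rw [div_le_one (by linarith [hfac k])]; exact hfac k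
    calc _ ≤ 1 * |∫ θ, reTrigSum b θ ^ k ∂μ - ∫ θ, reTrigSum b θ ^ k ∂ν| := by gcongr
      _ ≤ _ := by rw [one_mul]; exact h5.trans (hBk k hk')
  have h4 : (∫ θ, reTrigSum b θ ^ K ∂μ) / K.factorial ≤
      (∫ θ, reTrigSum b θ ^ K ∂ν) / K.factorial + B ^ K * δ := by
    have h5 := (le_abs_self _).trans
      ((norm_integral_reTrigSum_pow_sub_le h b le_rfl).trans (hBk K le_rfl))
    rw [div_add' _ _ _ (by linarith [hfac K])]
    gcongr
    nlinarith [hfac K, mul_nonneg (pow_nonneg (zero_le_one.trans hB1) K) hδ]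
  have h5 := norm_sub_le_norm_sub_add_norm_sub
    (∫ θ, Complex.exp (Complex.I * reTrigSum b θ) ∂μ)
    (∑ k ∈ Finset.range K, Complex.I ^ k / k.factorial *
        ((∫ θ, reTrigSum b θ ^ k ∂μ : ℝ) : ℂ)) (∫ θ, Complex.exp (Complex.I * reTrigSum b θ) ∂ν)
  have h6 := norm_sub_le_norm_sub_add_norm_sub
    (∑ k ∈ Finset.range K, Complex.I ^ k / k.factorial *
        ((∫ θ, reTrigSum b θ ^ k ∂μ : ℝ) : ℂ))
    (∑ k ∈ Finset.range K, Complex.I ^ k / k.factorial *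
        ((∫ θ, reTrigSum b θ ^ k ∂ν : ℝ) : ℂ)) (∫ θ, Complex.exp (Complex.I * reTrigSum b θ) ∂ν)
  rw [norm_sub_rev (∑ k ∈ Finset.range K, Complex.I ^ k / k.factorial *
        ((∫ θ, reTrigSum b θ ^ k ∂ν : ℝ) : ℂ))] at h6
  linarith

end Comparison

end TrigSum

/-! ### The model of independent uniform angles -/

/-- The uniform distribution on the angles `(0, 2π]`. -/
noncomputable def uniformAngle : Measure ℝ :=
  ProbabilityTheory.cond volume (Set.Ioc 0 (2 * Real.pi))

instance : IsProbabilityMeasure uniformAngle :=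
  cond_isProbabilityMeasure_of_finite (by simp [Real.pi_pos])
    (by rw [Real.volume_Ioc]; exact ENNReal.ofReal_ne_top)

theorem integral_uniformAngle {E : Type*} [NormedAddCommGroup E] [NormedSpace ℝ E] (f : ℝ → E) :
    ∫ θ, f θ ∂uniformAngle = (2 * Real.pi)⁻¹ • ∫ θ in (0 : ℝ)..(2 * Real.pi), f θ := by
  rw [uniformAngle, ProbabilityTheory.cond, integral_smul_measure,
    intervalIntegral.integral_of_le (by positivity)]
  congr 1
  simp only [Real.volume_Ioc, sub_zero, ENNReal.toReal_inv]
  rw [ENNReal.toReal_ofReal (by positivity)]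

theorem integral_exp_int_mul_uniformAngle (n : ℤ) :
    ∫ θ, Complex.exp (Complex.I * ((n * θ : ℝ) : ℂ)) ∂uniformAngle = if n = 0 then 1 else 0 := by
  split_ifs with hn
  · simp [hn]
  · rw [integral_uniformAngle]
    have hc : Complex.I * (n : ℂ) ≠ 0 := mul_ne_zero Complex.I_ne_zero (by exact_mod_cast hn)
    have h1 : ∀ θ : ℝ, Complex.I * ((n * θ : ℝ) : ℂ) = Complex.I * (n : ℂ) * θ := by
      intro θ
      push_cast
      ring
    simp_rw [h1]
    rw [integral_exp_mul_complex hc]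
    have h2 : Complex.I * (n : ℂ) * ((2 * Real.pi : ℝ) : ℂ) = n * (2 * Real.pi * Complex.I) := by
      push_cast
      ring
    rw [h2, Complex.exp_int_mul_two_pi_mul_I]
    simp

theorem re_mul_exp_I_mul (b : ℂ) (θ : ℝ) :
    (b * Complex.exp (Complex.I * θ)).re = b.re * Real.cos θ - b.im * Real.sin θ := by
  rw [mul_comm Complex.I, Complex.exp_mul_I]
  simp [Complex.cos_ofReal_re, Complex.sin_ofReal_re]

theorem integrable_uniformAngle {E : Type*} [NormedAddCommGroup E] {f : ℝ → E}
    (hf : Continuous f) : Integrable f uniformAngle := by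
  rw [uniformAngle, ProbabilityTheory.cond]
  refine Integrable.smul_measure ?_ (by simp [Real.pi_pos])
  exact (hf.integrableOn_Icc (a := 0) (b := 2 * Real.pi)).mono_set Set.Ioc_subset_Icc_self

theorem integral_re_mul_exp_uniformAngle (b : ℂ) :
    ∫ θ, (b * Complex.exp (Complex.I * (θ : ℝ))).re ∂uniformAngle = 0 := by
  simp_rw [re_mul_exp_I_mul]
  rw [integral_sub (integrable_uniformAngle (by fun_prop)) (integrable_uniformAngle (by fun_prop)),
    integral_const_mul, integral_const_mul, integral_uniformAngle, integral_uniformAngle]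
  simp

theorem integral_re_mul_exp_sq_uniformAngle (b : ℂ) :
    ∫ θ, (b * Complex.exp (Complex.I * (θ : ℝ))).re ^ 2 ∂uniformAngle = ‖b‖ ^ 2 / 2 := by
  have h : ∀ θ : ℝ, (b * Complex.exp (Complex.I * θ)).re ^ 2 =
      b.re ^ 2 * Real.cos θ ^ 2 - 2 * b.re * b.im * (Real.sin θ * Real.cos θ) +
        b.im ^ 2 * Real.sin θ ^ 2 := by
    intro θ
    rw [re_mul_exp_I_mul]
    ring
  simp_rw [h]
  rw [integral_add (integrable_uniformAngle (by fun_prop)) (integrable_uniformAngle (by fun_prop)),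
    integral_sub (integrable_uniformAngle (by fun_prop)) (integrable_uniformAngle (by fun_prop)),
    integral_const_mul, integral_const_mul, integral_const_mul, integral_uniformAngle,
    integral_uniformAngle, integral_uniformAngle, integral_cos_sq, integral_sin_sq,
    integral_sin_mul_cos₁, ← Complex.normSq_eq_norm_sq, Complex.normSq_apply]
  have := Real.pi_pos.ne'
  simp
  field_simp

/-- Both quantities lie within `‖b‖ ^ 3` of `1 - ‖b‖² / 4`, since the variable has mean `0` and
second moment `‖b‖² / 2`. -/
theorem norm_integral_cexp_re_uniformAngle_sub_le {b : ℂ} (hb : ‖b‖ ≤ 1) :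
    ‖∫ θ, Complex.exp (Complex.I * (b * Complex.exp (Complex.I * (θ : ℝ))).re) ∂uniformAngle -
      Real.exp (-(‖b‖ ^ 2 / 4))‖ ≤ 2 * ‖b‖ ^ 3 := by
  set Z : ℝ → ℝ := fun θ => (b * Complex.exp (Complex.I * θ)).re with hZ
  have hZc : Continuous Z := by fun_prop
  have h1 : ((1 - ‖b‖ ^ 2 / 4 : ℝ) : ℂ) =
      ∫ θ, ∑ k ∈ Finset.range 3, (Complex.I * (Z θ : ℂ)) ^ k / k.factorial ∂uniformAngle := by
    have h2 : ∀ θ, ∑ k ∈ Finset.range 3, (Complex.I * (Z θ : ℂ)) ^ k / k.factorial =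
        1 + (Complex.I * (Z θ : ℂ) - ((Z θ ^ 2 : ℝ) : ℂ) / 2) := by
      intro θ
      simp [Finset.sum_range_succ, mul_pow]
      ring
    simp_rw [h2]
    rw [integral_add (integrable_uniformAngle (by fun_prop))
      (integrable_uniformAngle (by fun_prop)),
      integral_sub (integrable_uniformAngle (by fun_prop)) (integrable_uniformAngle (by fun_prop)),
      integral_const_mul, integral_div, integral_complex_ofReal, integral_complex_ofReal,
      integral_re_mul_exp_uniformAngle, integral_re_mul_exp_sq_uniformAngle]
    simp
    ring
  have h3 : ‖∫ θ, Complex.exp (Complex.I * Z θ) ∂uniformAngle - ((1 - ‖b‖ ^ 2 / 4 : ℝ) : ℂ)‖ ≤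
      ‖b‖ ^ 3 := by
    rw [h1, ← integral_sub (integrable_uniformAngle (by fun_prop))
      (integrable_uniformAngle (by fun_prop))]
    refine (norm_integral_le_of_norm_le_const (C := ‖b‖ ^ 3) (ae_of_all _ fun θ => ?_)).trans
      (by simp)
    refine (norm_exp_I_mul_sub_sum_le _ 3).trans ?_
    have := pow_le_pow_left₀ (abs_nonneg _) (abs_re_mul_exp_le b θ) 3
    have h0 : 0 ≤ |Z θ| ^ 3 := by positivity
    refine le_trans ?_ this
    exact div_le_self h0 (by norm_num [Nat.factorial])
  have h4 : ‖((1 - ‖b‖ ^ 2 / 4 : ℝ) : ℂ) - Real.exp (-(‖b‖ ^ 2 / 4))‖ ≤ ‖b‖ ^ 3 := by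
    rw [← Complex.ofReal_sub, Complex.norm_real, norm_sub_rev]
    have h0 := norm_nonneg b
    have h5 := Real.norm_exp_sub_one_sub_id_le (x := -(‖b‖ ^ 2 / 4))
      (by rw [norm_neg, Real.norm_of_nonneg (by positivity)]; nlinarith)
    rw [norm_neg, Real.norm_of_nonneg (by positivity : 0 ≤ ‖b‖ ^ 2 / 4)] at h5
    rw [show Real.exp (-(‖b‖ ^ 2 / 4)) - (1 - ‖b‖ ^ 2 / 4) =
      Real.exp (-(‖b‖ ^ 2 / 4)) - 1 - -(‖b‖ ^ 2 / 4) by ring]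
    refine h5.trans ?_
    nlinarith [pow_nonneg h0 3]
  have := norm_sub_le_norm_sub_add_norm_sub (∫ θ, Complex.exp (Complex.I * Z θ) ∂uniformAngle)
    ((1 - ‖b‖ ^ 2 / 4 : ℝ) : ℂ) (Real.exp (-(‖b‖ ^ 2 / 4)) : ℂ)
  linarith

/-- Integrate `exp x ≤ 1 + x + x²`, valid for `|x| ≤ 1`; the linear term has mean zero. -/
theorem integral_exp_re_uniformAngle_le {b : ℂ} (hb : ‖b‖ ≤ 1) :
    ∫ θ, Real.exp (b * Complex.exp (Complex.I * (θ : ℝ))).re ∂uniformAngle ≤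
      Real.exp (‖b‖ ^ 2 / 2) := by
  have h1 : ∫ θ, Real.exp (b * Complex.exp (Complex.I * (θ : ℝ))).re ∂uniformAngle ≤
      ∫ θ, (1 + ((b * Complex.exp (Complex.I * (θ : ℝ))).re +
        (b * Complex.exp (Complex.I * (θ : ℝ))).re ^ 2)) ∂uniformAngle := by
    refine integral_mono (integrable_uniformAngle (by fun_prop))
      (integrable_uniformAngle (by fun_prop)) fun θ => ?_
    have := (le_abs_self _).trans
      (Real.abs_exp_sub_one_sub_id_le ((abs_re_mul_exp_le b θ).trans hb))
    beta_reduce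
    linarith
  refine h1.trans ?_
  rw [integral_add (integrable_uniformAngle (by fun_prop)) (integrable_uniformAngle (by fun_prop)),
    integral_add (integrable_uniformAngle (by fun_prop)) (integrable_uniformAngle (by fun_prop)),
    integral_re_mul_exp_uniformAngle, integral_re_mul_exp_sq_uniformAngle]
  have := Real.add_one_le_exp (‖b‖ ^ 2 / 2)
  simp
  linarith

theorem norm_prod_sub_prod_le {ι : Type*} (s : Finset ι) (f g : ι → ℂ)
    (hf : ∀ i ∈ s, ‖f i‖ ≤ 1) (hg : ∀ i ∈ s, ‖g i‖ ≤ 1) :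
    ‖∏ i ∈ s, f i - ∏ i ∈ s, g i‖ ≤ ∑ i ∈ s, ‖f i - g i‖ := by
  classical
  induction s using Finset.induction_on with
  | empty => simp
  | insert i s hi ih =>
    rw [Finset.prod_insert hi, Finset.prod_insert hi, Finset.sum_insert hi]
    have h1 := ih (fun j hj => hf j (Finset.mem_insert_of_mem hj))
      fun j hj => hg j (Finset.mem_insert_of_mem hj)
    have h2 : ‖∏ j ∈ s, g j‖ ≤ 1 := by
      rw [norm_prod]
      exact Finset.prod_le_one (fun _ _ => norm_nonneg _)
        fun j hj => hg j (Finset.mem_insert_of_mem hj)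
    have h3 : f i * ∏ j ∈ s, f j - g i * ∏ j ∈ s, g j =
        f i * (∏ j ∈ s, f j - ∏ j ∈ s, g j) + (f i - g i) * ∏ j ∈ s, g j := by ring
    rw [h3]
    refine (norm_add_le _ _).trans ?_
    rw [norm_mul, norm_mul]
    have h4 := hf i (Finset.mem_insert_self i s)
    nlinarith [norm_nonneg (∏ j ∈ s, f j - ∏ j ∈ s, g j), norm_nonneg (f i - g i)]

section Torus

variable {ι : Type*} [Fintype ι]

/-- The uniform distribution on a torus of independent angles. -/
noncomputable def uniformTorus (ι : Type*) [Fintype ι] : Measure (ι → ℝ) :=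
  Measure.pi fun _ => uniformAngle

instance : IsProbabilityMeasure (uniformTorus ι) := by
  unfold uniformTorus
  infer_instance

theorem integral_torusChar_uniformTorus (n : ι → ℤ) :
    ∫ θ, torusChar n θ ∂uniformTorus ι = if n = 0 then 1 else 0 := by
  have h1 : ∀ θ : ι → ℝ, torusChar n θ =
      ∏ i, Complex.exp (Complex.I * ((n i * θ i : ℝ) : ℂ)) := by
    intro θ
    rw [torusChar, ← Complex.exp_sum, Complex.ofReal_sum, Finset.mul_sum]
  simp_rw [h1]
  rw [uniformTorus, integral_fintype_prod_eq_prod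
    (fun i θ => Complex.exp (Complex.I * ((n i * θ : ℝ) : ℂ)))]
  simp_rw [integral_exp_int_mul_uniformAngle]
  split_ifs with hn
  · simp [hn]
  · obtain ⟨i, hi⟩ := Function.ne_iff.mp hn
    exact Finset.prod_eq_zero (Finset.mem_univ i) (if_neg hi)

/-- Independence factors the integral, and all factors have modulus at most `1`, so the errors `2 ‖b
i‖ ^ 3` merely add up. One power of each is absorbed in `η`. -/
theorem norm_integral_cexp_uniformTorus_sub_le (b : ι → ℂ) {η : ℝ} (hη : η ≤ 1)
    (hb : ∀ i, ‖b i‖ ≤ η) :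
    ‖∫ θ, Complex.exp (Complex.I * reTrigSum b θ) ∂uniformTorus ι -
      Real.exp (-((∑ i, ‖b i‖ ^ 2) / 4))‖ ≤ 2 * η * ∑ i, ‖b i‖ ^ 2 := by
  have h1 : ∀ θ : ι → ℝ, Complex.exp (Complex.I * reTrigSum b θ) =
      ∏ i, Complex.exp (Complex.I * (b i * Complex.exp (Complex.I * θ i)).re) := by
    intro θ
    rw [reTrigSum, ← Complex.exp_sum, Complex.ofReal_sum, Finset.mul_sum]
  simp_rw [h1]
  rw [uniformTorus, integral_fintype_prod_eq_prod
    (fun i (θ : ℝ) => Complex.exp (Complex.I * (b i * Complex.exp (Complex.I * θ)).re))]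
  have h2 : ((Real.exp (-((∑ i, ‖b i‖ ^ 2) / 4)) : ℝ) : ℂ) =
      ∏ i, ((Real.exp (-(‖b i‖ ^ 2 / 4)) : ℝ) : ℂ) := by
    rw [← Complex.ofReal_prod, ← Real.exp_sum, Finset.sum_neg_distrib, Finset.sum_div]
  rw [h2]
  refine (norm_prod_sub_prod_le _ _ _ (fun i _ => ?_) fun i _ => ?_).trans ?_
  · refine (norm_integral_le_of_norm_le_const (C := 1) (ae_of_all _ fun θ => ?_)).trans (by simp)
    exact (Complex.norm_exp_I_mul_ofReal _).le
  · rw [Complex.norm_real, Real.norm_of_nonneg (Real.exp_pos _).le, Real.exp_le_one_iff]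
    linarith [sq_nonneg ‖b i‖]
  · rw [Finset.mul_sum]
    refine Finset.sum_le_sum fun i _ => ?_
    refine (norm_integral_cexp_re_uniformAngle_sub_le ((hb i).trans hη)).trans ?_
    have := mul_le_mul_of_nonneg_right (hb i) (sq_nonneg ‖b i‖)
    calc 2 * ‖b i‖ ^ 3 = 2 * (‖b i‖ * ‖b i‖ ^ 2) := by ring
      _ ≤ 2 * (η * ‖b i‖ ^ 2) := by linarith
      _ = _ := by ring

theorem integral_exp_reTrigSum_uniformTorus_le (b : ι → ℂ) (hb : ∀ i, ‖b i‖ ≤ 1) :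
    ∫ θ, Real.exp (reTrigSum b θ) ∂uniformTorus ι ≤ Real.exp ((∑ i, ‖b i‖ ^ 2) / 2) := by
  have h1 : ∀ θ : ι → ℝ, Real.exp (reTrigSum b θ) =
      ∏ i, Real.exp (b i * Complex.exp (Complex.I * θ i)).re := by
    intro θ
    rw [reTrigSum, ← Real.exp_sum]
  simp_rw [h1]
  rw [uniformTorus, integral_fintype_prod_eq_prod
    (fun i (θ : ℝ) => Real.exp (b i * Complex.exp (Complex.I * θ)).re), Finset.sum_div,
    Real.exp_sum]
  exact Finset.prod_le_prod (fun i _ => integral_nonneg fun θ => (Real.exp_pos _).le)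
    fun i _ => integral_exp_re_uniformAngle_le (hb i)

/-- Apply `|2y| ^ K / K! ≤ exp (2y) + exp (-2y)` and the exponential moment bound to `±2b`, whence
the condition `1 / 2`. The dilation by `2` produces the decay `2 ^ (-K)`. -/
theorem integral_reTrigSum_pow_uniformTorus_le (b : ι → ℂ) (hb : ∀ i, ‖b i‖ ≤ 1 / 2) {K : ℕ}
    (hK : Even K) :
    (∫ θ, reTrigSum b θ ^ K ∂uniformTorus ι) / K.factorial ≤
      2 * Real.exp (2 * ∑ i, ‖b i‖ ^ 2) / 2 ^ K := by
  have hpos : ∀ ε : ℂ, ‖ε‖ = 2 → ∫ θ, Real.exp (reTrigSum (fun i => ε * b i) θ) ∂uniformTorus ι ≤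
      Real.exp (2 * ∑ i, ‖b i‖ ^ 2) := by
    intro ε hε
    refine (integral_exp_reTrigSum_uniformTorus_le _ fun i => ?_).trans (le_of_eq ?_)
    · rw [norm_mul, hε]
      linarith [hb i]
    · simp_rw [norm_mul, hε, mul_pow]
      rw [← Finset.mul_sum]
      congr 1
      ring
  have hscale : ∀ (r : ℝ) (θ : ι → ℝ),
      reTrigSum (fun i => (r : ℂ) * b i) θ = r * reTrigSum b θ := by
    intro r θ
    rw [reTrigSum, reTrigSum, Finset.mul_sum]
    refine Finset.sum_congr rfl fun i _ => ?_
    rw [mul_assoc, Complex.re_ofReal_mul]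
  have h1 : ∀ θ : ι → ℝ, reTrigSum b θ ^ K * (2 ^ K / K.factorial) ≤
      Real.exp (reTrigSum (fun i => ((2 : ℝ) : ℂ) * b i) θ) +
        Real.exp (reTrigSum (fun i => ((-2 : ℝ) : ℂ) * b i) θ) := by
    intro θ
    rw [hscale, hscale]
    set y := reTrigSum b θ
    have h2 := Real.pow_div_factorial_le_exp (|2 * y|) (abs_nonneg _) K
    rw [hK.pow_abs, mul_pow] at h2
    calc y ^ K * (2 ^ K / K.factorial) = 2 ^ K * y ^ K / K.factorial := by ring
      _ ≤ Real.exp |2 * y| := h2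
      _ ≤ _ := by
        rcases abs_choice (2 * y) with h | h <;> rw [h]
        · linarith [Real.exp_pos (-2 * y)]
        · rw [← neg_mul]; linarith [Real.exp_pos (2 * y)]
  have h2 := integral_mono ((integrable_reTrigSum_pow (uniformTorus ι) b K).mul_const _)
    ((integrable_exp_reTrigSum _ _).add (integrable_exp_reTrigSum _ _)) h1
  rw [integral_mul_const, integral_add' (integrable_exp_reTrigSum _ _)
    (integrable_exp_reTrigSum _ _)] at h2
  have h3 := hpos ((2 : ℝ) : ℂ) (by simp)
  have h4 := hpos ((-2 : ℝ) : ℂ) (by simp)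
  rw [le_div_iff₀ (by positivity)]
  calc _ = (∫ θ, reTrigSum b θ ^ K ∂uniformTorus ι) * (2 ^ K / K.factorial) := by ring
    _ ≤ _ := by linarith

end Torus

/-! ### Separation of logarithms of primes and the law of the actual angles -/

theorem one_div_le_abs_log_sub_log {A B N : ℕ} (hA : 0 < A) (hB : 0 < B) (hAN : A ≤ N)
    (hBN : B ≤ N) (h : A ≠ B) : 1 / (N : ℝ) ≤ |Real.log A - Real.log B| := by
  wlog hlt : A < B generalizing A B
  · rw [abs_sub_comm]
    exact this hB hA hBN hAN h.symm (by omega)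
  have hA' : (0 : ℝ) < A := by exact_mod_cast hA
  have hB' : (0 : ℝ) < B := by exact_mod_cast hB
  rw [abs_sub_comm, ← Real.log_div hB'.ne' hA'.ne']
  refine le_trans ?_ (le_abs_self _)
  have h1 := Real.one_sub_inv_le_log_of_pos (div_pos hB' hA')
  have h2 : (1 : ℝ) / B ≤ 1 - ((B : ℝ) / A)⁻¹ := by
    rw [inv_div, le_sub_iff_add_le, ← add_div, div_le_one hB']
    exact_mod_cast (by omega : 1 + A ≤ B)
  refine le_trans ?_ (h2.trans h1)
  gcongr

/-- Integer combinations of the logarithms of distinct primes are well separated from zero. -/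
theorem one_div_pow_le_abs_sum_mul_log {ι : Type*} [Fintype ι] {p : ι → ℕ} (hp : ∀ i, (p i).Prime)
    (hinj : Function.Injective p) {M K : ℕ} (hM : 1 ≤ M) (hpM : ∀ i, p i ≤ M) {n : ι → ℤ}
    (hn : n ≠ 0) (hnK : ∑ i, |n i| ≤ K) :
    1 / (M : ℝ) ^ K ≤ |∑ i, (n i : ℝ) * Real.log (p i)| := by
  -- Separate positive and negative exponents: the combination equals `log A - log B`. Both integers
  -- are at most `M ^ K`, and they differ by unique factorization.
  set A : ℕ := ∏ i, p i ^ (n i).toNat with hA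
  set B : ℕ := ∏ i, p i ^ (-n i).toNat with hB
  have hfac : ∀ (e : ι → ℕ) (j : ι), (∏ i, p i ^ e i).factorization (p j) = e j := by
    classical
    intro e j
    rw [Nat.factorization_prod fun i _ => pow_ne_zero _ (hp i).ne_zero, Finsupp.finsetSum_apply]
    simp_rw [fun i => (hp i).factorization_pow (k := e i), Finsupp.single_apply, hinj.eq_iff]
    simp
  have hle : ∀ e : ι → ℕ, (∀ i, (e i : ℤ) ≤ |n i|) → ∏ i, p i ^ e i ≤ M ^ K := by
    intro e he
    refine (Finset.prod_le_prod' fun i _ => Nat.pow_le_pow_left (hpM i) (e i)).trans ?_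
    rw [Finset.prod_pow_eq_pow_sum]
    refine Nat.pow_le_pow_right hM ?_
    have := (Finset.sum_le_sum fun i (_ : i ∈ Finset.univ) => he i).trans hnK
    exact_mod_cast this
  have hAB : A ≠ B := by
    intro hAB
    obtain ⟨j, hj⟩ := Function.ne_iff.mp hn
    have h1 := hfac (fun i => (n i).toNat) j
    have h2 := hfac (fun i => (-n i).toNat) j
    rw [← hA, hAB, hB, h2] at h1
    simp only [Pi.zero_apply] at hj
    omega
  have hpos : ∀ e : ι → ℕ, 0 < ∏ i, p i ^ e i := fun e =>
    Finset.prod_pos fun i _ => pow_pos (hp i).pos _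
  have h := one_div_le_abs_log_sub_log (hpos _) (hpos _)
    (hle (fun i => (n i).toNat) fun i => by rw [Int.abs_eq_natAbs]; omega)
    (hle (fun i => (-n i).toNat) fun i => by rw [Int.abs_eq_natAbs]; omega) hAB
  rw [Nat.cast_pow] at h
  refine h.trans (le_of_eq ?_)
  congr 1
  have hlog : ∀ e : ι → ℕ, Real.log ((∏ i, p i ^ e i : ℕ) : ℝ) =
      ∑ i, (e i : ℝ) * Real.log (p i) := by
    intro e
    push_cast
    rw [Real.log_prod fun i _ => pow_ne_zero _ (by exact_mod_cast (hp i).ne_zero)]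
    simp
  rw [hlog, hlog, ← Finset.sum_sub_distrib]
  refine Finset.sum_congr rfl fun i _ => ?_
  rw [← sub_mul]
  congr 1
  have : ((n i).toNat : ℤ) - (-n i).toNat = n i := by omega
  exact_mod_cast this

theorem norm_setIntegral_cexp_mul_le {y : ℝ} (hy : y ≠ 0) :
    ‖∫ u in Set.Ioo (0 : ℝ) 1, Complex.exp (Complex.I * ((u * y : ℝ) : ℂ))‖ ≤ 2 / |y| := by
  have hc : Complex.I * (y : ℂ) ≠ 0 := mul_ne_zero Complex.I_ne_zero (by exact_mod_cast hy)
  have h1 : ∀ u : ℝ, Complex.I * ((u * y : ℝ) : ℂ) = Complex.I * (y : ℂ) * u := by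
    intro u
    push_cast
    ring
  simp_rw [h1]
  rw [← integral_Ioc_eq_integral_Ioo, ← intervalIntegral.integral_of_le zero_le_one,
    integral_exp_mul_complex hc, norm_div, norm_mul, Complex.norm_I, one_mul, Complex.norm_real,
    Real.norm_eq_abs]
  gcongr
  refine (norm_sub_le _ _).trans ?_
  simp [Complex.norm_exp]
  norm_num

/-- The law of the angles `-u t log p`, `p ∈ s`, when `u` is uniform on `(0, 1)`. -/
noncomputable def logAngleLaw (s : Finset Nat.Primes) (t : ℝ) : Measure (s → ℝ) :=
  (volume.restrict (Set.Ioo (0 : ℝ) 1)).map fun u p => -(u * (t * Real.log (p.1 : ℕ)))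

theorem measurable_logAngle (s : Finset Nat.Primes) (t : ℝ) :
    Measurable fun (u : ℝ) (p : s) => -(u * (t * Real.log (p.1 : ℕ))) := by
  fun_prop

instance (s : Finset Nat.Primes) (t : ℝ) : IsProbabilityMeasure (logAngleLaw s t) := by
  have : IsProbabilityMeasure (volume.restrict (Set.Ioo (0 : ℝ) 1)) := ⟨by simp⟩
  exact Measure.isProbabilityMeasure_map (measurable_logAngle s t).aemeasurable

/-- For `n ≠ 0` the model mean is `0`, and the actual one is the mean of a single oscillation of
frequency `t L`, at most `2 / (t |L|)` with `|L| ≥ M ^ (-K)`. -/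
theorem norm_integral_torusChar_logAngleLaw_sub_le {s : Finset Nat.Primes} {t : ℝ} (ht : 0 < t)
    {M K : ℕ} (hM : 1 ≤ M) (hs : ∀ p ∈ s, (p : ℕ) ≤ M) (n : s → ℤ) (hn : ∑ i, |n i| ≤ K) :
    ‖∫ θ, torusChar n θ ∂logAngleLaw s t - ∫ θ, torusChar n θ ∂uniformTorus s‖ ≤
      2 * (M : ℝ) ^ K / t := by
  rw [integral_torusChar_uniformTorus]
  split_ifs with h0
  · have : ∀ θ, torusChar n θ = 1 := by simp [h0, torusChar]
    simp only [this]
    simp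
    positivity
  rw [sub_zero, logAngleLaw, integral_map (measurable_logAngle s t).aemeasurable
    (continuous_torusChar n).aestronglyMeasurable]
  set L : ℝ := ∑ p : s, (n p : ℝ) * Real.log (p.1 : ℕ) with hL
  have h1 : ∀ u : ℝ, torusChar n (fun p : s => -(u * (t * Real.log (p.1 : ℕ)))) =
      Complex.exp (Complex.I * ((u * (-(t * L)) : ℝ) : ℂ)) := by
    intro u
    rw [torusChar, hL, Finset.mul_sum, ← Finset.sum_neg_distrib, Finset.mul_sum]
    congr 3
    exact Finset.sum_congr rfl fun p _ => by ring
  simp_rw [h1]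
  have hsep := one_div_pow_le_abs_sum_mul_log (p := fun p : s => ((p.1 : Nat.Primes) : ℕ))
    (fun p => p.1.2) (fun p q h => Subtype.ext (Nat.Primes.coe_nat_injective h)) hM
    (fun p => hs p.1 p.2) h0 hn
  rw [← hL] at hsep
  have hMpos : (0 : ℝ) < (M : ℝ) ^ K := by
    have : (0 : ℝ) < M := by exact_mod_cast hM
    positivity
  have hLpos : 0 < |L| := lt_of_lt_of_le (by positivity) hsep
  have hLne : L ≠ 0 := abs_pos.mp hLpos
  refine (norm_setIntegral_cexp_mul_le (neg_ne_zero.mpr (mul_ne_zero ht.ne' hLne))).trans ?_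
  rw [abs_neg, abs_mul, abs_of_pos ht, div_le_div_iff₀ (by positivity) ht]
  rw [div_le_iff₀ hMpos] at hsep
  nlinarith

/-! ### Unconditional `L²` convergence and characteristic functions of finite sums -/

/-- Cauchy's criterion in the complete space `Lp ℂ 2 P`: a finite sum avoiding a large `s` is
controlled by the tail of the finite series `∑ g`. -/
theorem exists_tendsto_eLpNorm_sum_sub {Ω ι : Type*} [MeasurableSpace Ω] {P : Measure Ω}
    (f : ι → Ω → ℂ) (hf : ∀ i, MemLp (f i) 2 P) (g : ι → ℝ≥0∞) {C : ℝ≥0∞} (hC : C ≠ ∞)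
    (hg : ∑' i, g i ≠ ∞)
    (h : ∀ s : Finset ι, eLpNorm (fun x => ∑ i ∈ s, f i x) 2 P ^ 2 ≤ C * ∑ i ∈ s, g i) :
    ∃ X : Ω → ℂ, MemLp X 2 P ∧
      Tendsto (fun s : Finset ι => eLpNorm (fun x => ∑ i ∈ s, f i x - X x) 2 P) atTop (𝓝 0) := by
  classical
  set v : ι → Lp ℂ 2 P := fun i => (hf i).toLp (f i) with hv
  have hsum : ∀ s : Finset ι, (∑ i ∈ s, v i : Lp ℂ 2 P) =ᵐ[P] fun x => ∑ i ∈ s, f i x := by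
    intro s
    induction s using Finset.induction_on with
    | empty =>
      filter_upwards [Lp.coeFn_zero ℂ 2 P] with x h1
      rw [Finset.sum_empty, Finset.sum_empty, h1, Pi.zero_apply]
    | insert i s hi ih =>
      rw [Finset.sum_insert hi]
      filter_upwards [ih, Lp.coeFn_add (v i) (∑ j ∈ s, v j), (hf i).coeFn_toLp] with x h1 h2 h3
      rw [h2, Pi.add_apply, h1, h3, Finset.sum_insert hi]
  have hsummable : Summable v := by
    rw [summable_iff_vanishing_norm]
    intro ε hε
    have htend : Tendsto (fun s : Finset ι => C * ∑' i : { x // x ∉ s }, g i) atTop (𝓝 0) := by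
      have := ENNReal.Tendsto.const_mul (a := C) (ENNReal.tendsto_tsum_compl_atTop_zero hg)
        (Or.inr hC)
      simpa using this
    have hε2 : (0 : ℝ≥0∞) < ENNReal.ofReal ε ^ 2 := by
      rw [← ENNReal.ofReal_pow hε.le]
      exact ENNReal.ofReal_pos.mpr (by positivity)
    obtain ⟨s, hs⟩ := (htend.eventually (gt_mem_nhds hε2)).exists
    refine ⟨s, fun r hr => ?_⟩
    rw [Lp.norm_def, eLpNorm_congr_ae (hsum r)]
    have h1 : eLpNorm (fun x => ∑ i ∈ r, f i x) 2 P ^ 2 < ENNReal.ofReal ε ^ 2 := by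
      refine lt_of_le_of_lt ((h r).trans ?_) hs
      gcongr
      rw [← Finset.sum_subtype_of_mem g fun i hi => Finset.disjoint_left.mp hr hi]
      exact ENNReal.sum_le_tsum _
    have h2 := lt_of_pow_lt_pow_left' 2 h1
    exact (ENNReal.lt_ofReal_iff_toReal_lt (ne_top_of_lt h2)).mp h2
  refine ⟨_, Lp.memLp (∑' i, v i), ?_⟩
  have hlim := hsummable.hasSum
  rw [HasSum, SummationFilter.unconditional_filter, Lp.tendsto_Lp_iff_tendsto_eLpNorm'] at hlim
  refine hlim.congr fun s => eLpNorm_congr_ae ?_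
  filter_upwards [hsum s] with x hx
  rw [Pi.sub_apply, hx]

section UniformVariable

variable {Ω : Type*} [MeasurableSpace Ω] {P : Measure Ω} {ω : Ω → ℝ}

/-- The real inner product on `ℂ` is `Re (w * conj z)`, so pairing with `z` just multiplies the
coefficients by `conj z`. -/
theorem charFun_map_primeSum (hω : pdf.IsUniform ω (Set.Ioo (0 : ℝ) 1) P)
    (a : Nat.Primes → ℝ → ℂ) (s : Finset Nat.Primes) (t : ℝ) (z : ℂ) :
    charFun (P.map fun x => primeSum a s t (ω x)) z =
      ∫ θ, Complex.exp (Complex.I * reTrigSum (fun p : s => a p.1 t * (starRingEnd ℂ) z) θ)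
        ∂logAngleLaw s t := by
  have hωm : AEMeasurable ω P := hω.aemeasurable (by simp) (by simp)
  have hc := continuous_primeSum a s t
  have hmap : P.map (fun x => primeSum a s t (ω x)) =
      (volume.restrict (Set.Ioo (0 : ℝ) 1)).map (primeSum a s t) := by
    rw [← map_eq_restrict_of_isUniform_Ioo hω, AEMeasurable.map_map_of_aemeasurable
      hc.measurable.aemeasurable hωm]
    rfl
  have hcr := continuous_reTrigSum (fun p : s => a p.1 t * (starRingEnd ℂ) z)
  rw [charFun_apply, hmap, integral_map hc.measurable.aemeasurable
    (Continuous.aestronglyMeasurable (by fun_prop)), logAngleLaw,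
    integral_map (measurable_logAngle s t).aemeasurable
    (Continuous.aestronglyMeasurable (by fun_prop))]
  refine integral_congr_ae (ae_of_all _ fun u => ?_)
  beta_reduce
  rw [mul_comm _ Complex.I, real_inner_comm, Complex.inner, primeSum_eq_sum_exp, Finset.sum_mul,
    Complex.re_sum, ← Finset.sum_coe_sort, reTrigSum]
  congr 3
  refine Finset.sum_congr rfl fun p _ => ?_
  rw [mul_right_comm]
  congr 3
  push_cast
  ring

/-- The three errors come from replacing the angles by independent ones, from the Taylor remainders,
and from the Gaussian approximation in the model. -/
theorem norm_charFun_map_primeSum_sub_le (hω : pdf.IsUniform ω (Set.Ioo (0 : ℝ) 1) P)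
    (a : Nat.Primes → ℝ → ℂ) (s : Finset Nat.Primes) {t : ℝ} (ht : 0 < t) (z : ℂ)
    {M K : ℕ} (hM : 1 ≤ M) (hs : ∀ p ∈ s, (p : ℕ) ≤ M) (hK : Even K) {η B Q : ℝ}
    (hη : η ≤ 1 / 2) (hη' : ∀ p, ‖a p t‖ * ‖z‖ ≤ η) (hB1 : 1 ≤ B)
    (hB : ∑ p ∈ s, ‖a p t‖ * ‖z‖ ≤ B) (hQ : ∑ p ∈ s, ‖a p t‖ ^ 2 = Q) :
    ‖charFun (P.map fun x => primeSum a s t (ω x)) z - Real.exp (-(Q * ‖z‖ ^ 2 / 4))‖ ≤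
      (K + 1) * (B ^ K * (2 * (M : ℝ) ^ K / t)) +
        2 * (2 * Real.exp (2 * (Q * ‖z‖ ^ 2)) / 2 ^ K) + 2 * η * (Q * ‖z‖ ^ 2) := by
  set b : s → ℂ := fun p => a p.1 t * (starRingEnd ℂ) z with hb
  have hnorm : ∀ p : s, ‖b p‖ = ‖a p.1 t‖ * ‖z‖ := by
    intro p
    rw [hb, norm_mul, RCLike.norm_conj]
  have hsq : ∑ p, ‖b p‖ ^ 2 = Q * ‖z‖ ^ 2 := by
    simp_rw [hnorm, mul_pow]
    rw [← Finset.sum_mul, ← hQ, Finset.sum_coe_sort s fun p => ‖a p t‖ ^ 2]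
  have h1 := norm_integral_cexp_reTrigSum_sub_le (μ := logAngleLaw s t) (ν := uniformTorus s)
    (fun n hn => norm_integral_torusChar_logAngleLaw_sub_le ht hM hs n hn) b hK hB1
    (by simp_rw [hnorm]; rw [Finset.sum_coe_sort s fun p => ‖a p t‖ * ‖z‖]; exact hB)
  have h2 := integral_reTrigSum_pow_uniformTorus_le b
    (fun p => by rw [hnorm]; exact (hη' _).trans hη) hK
  have h3 := norm_integral_cexp_uniformTorus_sub_le b (η := η) (by linarith)
    fun p => by rw [hnorm]; exact hη' _
  rw [hsq] at h2 h3
  rw [charFun_map_primeSum hω]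
  have h4 := norm_sub_le_norm_sub_add_norm_sub
    (∫ θ, Complex.exp (Complex.I * reTrigSum b θ) ∂logAngleLaw s t)
    (∫ θ, Complex.exp (Complex.I * reTrigSum b θ) ∂uniformTorus s)
    (Real.exp (-(Q * ‖z‖ ^ 2 / 4)) : ℂ)
  linarith

theorem memLp_primeSum [IsProbabilityMeasure P] (hω : pdf.IsUniform ω (Set.Ioo (0 : ℝ) 1) P)
    (a : Nat.Primes → ℝ → ℂ) (s : Finset Nat.Primes) (t : ℝ) :
    MemLp (fun x => primeSum a s t (ω x)) 2 P := by
  have hωm : AEMeasurable ω P := hω.aemeasurable (by simp) (by simp)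
  refine MemLp.of_bound
    ((continuous_primeSum a s t).measurable.comp_aemeasurable hωm).aestronglyMeasurable
    (∑ p ∈ s, ‖a p t‖) (ae_of_all _ fun x => ?_)
  rw [primeSum_eq_sum_exp]
  refine norm_sum_le_of_le _ fun p _ => ?_
  rw [show -(Complex.I * (ω x : ℂ) * ((t * Real.log (p : ℕ) : ℝ) : ℂ)) =
    Complex.I * ((-(ω x * (t * Real.log (p : ℕ))) : ℝ) : ℂ) by push_cast; ring,
    norm_mul, Complex.norm_exp_I_mul_ofReal, mul_one]

theorem exists_tendsto_eLpNorm_primeSum_sub [IsProbabilityMeasure P]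
    (hω : pdf.IsUniform ω (Set.Ioo (0 : ℝ) 1) P) (a : Nat.Primes → ℝ → ℂ) {t : ℝ} (ht : 2 ≤ t)
    (hfin : ∑' p : Nat.Primes, ‖a p t‖ₑ ^ 2 * ENNReal.ofReal (1 + ((p : ℕ) : ℝ) / t) ≠ ∞) :
    ∃ X : Ω → ℂ, MemLp X 2 P ∧
      Tendsto (fun s : Finset Nat.Primes => eLpNorm (fun x => primeSum a s t (ω x) - X x) 2 P)
        atTop (𝓝 0) := by
  have hsum : ∀ (s : Finset Nat.Primes) (x : Ω),
      ∑ p ∈ s, primeSum a {p} t (ω x) = primeSum a s t (ω x) := fun s x => by simp [primeSum]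
  have h := exists_tendsto_eLpNorm_sum_sub (P := P) (fun p x => primeSum a {p} t (ω x))
    (fun p => memLp_primeSum hω a {p} t) _ ENNReal.ofReal_ne_top hfin
    fun s => by simp_rw [hsum]; exact eLpNorm_primeSum_sq_le hω a s ht
  simpa only [hsum] using h

end UniformVariable

/-! ### The Gaussian limit and the split at `m t` -/

theorem charFun_map_mul_stdComplexNormal {Ω : Type*} [MeasurableSpace Ω] {P : Measure Ω}
    {Y : Ω → ℂ} (hY : IsStdComplexNormal Y P) (σ : ℝ) (z : ℂ) :
    charFun (P.map fun y => (σ : ℂ) * Y y) z = Real.exp (-(σ ^ 2 * ‖z‖ ^ 2 / 4)) := by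
  obtain ⟨N₁, N₂, h1, h2, hind, hYeq⟩ := hY
  have hYm : AEMeasurable (fun y => (σ : ℂ) * Y y) P := by
    rw [show Y = _ from funext hYeq]
    have := h1.aemeasurable
    have := h2.aemeasurable
    fun_prop
  rw [charFun_apply, integral_map hYm (Continuous.aestronglyMeasurable (by fun_prop))]
  have h3 : ∀ y, Complex.exp (inner ℝ ((σ : ℂ) * Y y) z * Complex.I) =
      Complex.exp (((σ * z.re / √2 : ℝ) : ℂ) * (N₁ y : ℂ) * Complex.I) *
        Complex.exp (((σ * z.im / √2 : ℝ) : ℂ) * (N₂ y : ℂ) * Complex.I) := by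
    intro y
    rw [← Complex.exp_add, ← add_mul]
    congr 2
    rw [Complex.inner, hYeq]
    norm_cast
    simp
    field_simp
    rw [Real.sq_sqrt (by norm_num)]
  simp_rw [h3]
  rw [hind.integral_fun_comp_mul_comp h1.aemeasurable h2.aemeasurable
    (f := fun x : ℝ => Complex.exp (((σ * z.re / √2 : ℝ) : ℂ) * (x : ℂ) * Complex.I))
    (g := fun x : ℝ => Complex.exp (((σ * z.im / √2 : ℝ) : ℂ) * (x : ℂ) * Complex.I))
    (Continuous.aestronglyMeasurable (by fun_prop))
    (Continuous.aestronglyMeasurable (by fun_prop))]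
  have h4 : ∀ {N : Ω → ℝ} (_ : HasLaw N (gaussianReal 0 1) P) (r : ℝ),
      ∫ y, Complex.exp ((r : ℂ) * (N y : ℂ) * Complex.I) ∂P = Complex.exp (-(r : ℂ) ^ 2 / 2) := by
    intro N hN r
    have := charFun_gaussianReal (μ := 0) (v := 1) r
    rw [← hN.map_eq, charFun_apply_real, integral_map hN.aemeasurable
      (Continuous.aestronglyMeasurable (by fun_prop))] at this
    rw [this]
    congr 1
    simp
    ring
  rw [h4 h1, h4 h2, ← Complex.exp_add, Complex.ofReal_exp]
  congr 1
  have h5 : (σ * z.re / √2) ^ 2 + (σ * z.im / √2) ^ 2 = σ ^ 2 * ‖z‖ ^ 2 / 2 := by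
    rw [← Complex.normSq_eq_norm_sq, Complex.normSq_apply, div_pow, div_pow,
      Real.sq_sqrt (by norm_num)]
    ring
  have h6 : ∀ x y : ℝ, -(x : ℂ) ^ 2 / 2 + -(y : ℂ) ^ 2 / 2 = ((-((x ^ 2 + y ^ 2) / 2) : ℝ) : ℂ) := by
    intro x y
    push_cast
    ring
  rw [h6, h5]
  ring_nf

theorem mem_primesUpTo {N : ℕ} {p : Nat.Primes} : p ∈ primesUpTo N ↔ (p : ℕ) ≤ N :=
  Finset.mem_subtype.trans (Finset.mem_range.trans Nat.lt_succ_iff)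

theorem mem_primesUpTo_floor {m : ℝ} (hm : 0 < m) {p : Nat.Primes} :
    p ∈ primesUpTo ⌊m⌋₊ ↔ ¬ m < ((p : ℕ) : ℝ) := by
  rw [mem_primesUpTo, Nat.le_floor_iff hm.le, not_lt]

theorem card_primesUpTo_le (N : ℕ) : (primesUpTo N).card ≤ N + 1 := by
  have h := Finset.card_le_card_of_injOn (s := primesUpTo N) (t := Finset.range (N + 1))
    (fun p => (p : ℕ)) (fun p hp => Finset.mem_coe.mpr
      (Finset.mem_range.mpr (Nat.lt_succ_of_le (mem_primesUpTo.mp hp))))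
    Nat.Primes.coe_nat_injective.injOn
  rwa [Finset.card_range] at h

theorem sum_le_tsum_subtype {ι : Type*} {q : ι → Prop} (F : ι → ℝ≥0∞) (s : Finset ι)
    (hs : ∀ i ∈ s, q i) : ∑ i ∈ s, F i ≤ ∑' i : {i // q i}, F i.1 := by
  classical
  rw [← Finset.sum_subtype_of_mem F hs]
  exact ENNReal.sum_le_tsum _

theorem tsum_le_sum_add_tsum_subtype {ι : Type*} {q : ι → Prop} (F : ι → ℝ≥0∞) (s : Finset ι)
    (hs : ∀ i, i ∈ s ↔ ¬ q i) : ∑' i, F i ≤ ∑ i ∈ s, F i + ∑' i : {i // q i}, F i.1 := by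
  classical
  rw [ENNReal.tsum_eq_iSup_sum]
  refine iSup_le fun r => ?_
  rw [← Finset.sum_filter_add_sum_filter_not r (· ∈ s)]
  refine add_le_add (Finset.sum_le_sum_of_subset fun i hi => (Finset.mem_filter.mp hi).2)
    (sum_le_tsum_subtype F _ fun i hi => ?_)
  have := (Finset.mem_filter.mp hi).2
  rwa [hs, not_not] at this

/-- A function that is `t ^ o(1)` has powers negligible against `t`. -/
theorem tendsto_max_one_floor_pow_div {m : ℝ → ℝ} (hmpos : ∀ᶠ t in atTop, 0 < m t)
    (hm : Tendsto (fun t : ℝ => Real.log (m t) / Real.log t) atTop (𝓝 0)) (k : ℕ) :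
    Tendsto (fun t : ℝ => ((max 1 ⌊m t⌋₊ : ℕ) : ℝ) ^ k / t) atTop (𝓝 0) := by
  have hlim : Tendsto (fun t : ℝ => t ^ (-(1 / 2 : ℝ))) atTop (𝓝 0) :=
    tendsto_rpow_neg_atTop (by norm_num)
  -- Chosen so that `k * log (m t) ≤ log t / 2` eventually; `k + 1` also covers `k = 0`.
  have hc : (0 : ℝ) < 1 / (2 * (k + 1)) := by positivity
  refine squeeze_zero' ?_ ?_ hlim
  · filter_upwards [eventually_gt_atTop 0] with t ht
    positivity
  · filter_upwards [hmpos, hm.eventually (gt_mem_nhds hc), eventually_gt_atTop 1] with t h1 h2 ht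
    have ht0 : 0 < t := by linarith
    have hlog : 0 < Real.log t := Real.log_pos ht
    have hsplit : t ^ (-(1 / 2 : ℝ)) = t ^ (1 / 2 : ℝ) / t := by
      rw [show (-(1 / 2 : ℝ)) = 1 / 2 - 1 by norm_num, Real.rpow_sub ht0, Real.rpow_one]
    rw [hsplit]
    refine div_le_div_of_nonneg_right ?_ ht0.le
    rcases le_total ⌊m t⌋₊ 1 with hf | hf
    · rw [max_eq_left hf]
      simpa using Real.one_le_rpow ht.le (by norm_num : (0 : ℝ) ≤ 1 / 2)
    · rw [max_eq_right hf]
      calc ((⌊m t⌋₊ : ℕ) : ℝ) ^ k ≤ m t ^ k := by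
            gcongr
            exact Nat.floor_le h1.le
        _ = Real.exp (k * Real.log (m t)) := by
            rw [← Real.log_pow, Real.exp_log (by positivity)]
        _ ≤ Real.exp (Real.log t * (1 / 2)) := by
            rw [Real.exp_le_exp]
            rw [div_lt_div_iff₀ hlog (by positivity)] at h2
            have hm1 : 0 ≤ Real.log (m t) := by
              refine Real.log_nonneg ?_
              exact le_trans (by exact_mod_cast hf) (Nat.floor_le h1.le)
            nlinarith
        _ = t ^ (1 / 2 : ℝ) := (Real.rpow_def_of_pos ht0 _).symm

theorem tendsto_charFun_map_primeSum {Ω : Type*} [MeasurableSpace Ω] {P : Measure Ω}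
    {ω : Ω → ℝ} (hω : pdf.IsUniform ω (Set.Ioo (0 : ℝ) 1) P) (a : Nat.Primes → ℝ → ℂ) {σ : ℝ}
    {N : ℝ → ℕ} (hN : ∀ k : ℕ, Tendsto (fun t : ℝ => ((max 1 (N t) : ℕ) : ℝ) ^ k / t) atTop (𝓝 0))
    {A : ℝ → ℝ} (hA : Tendsto A atTop (𝓝 0)) (haA : ∀ᶠ t in atTop, ∀ p, ‖a p t‖ ≤ A t)
    (hQ : Tendsto (fun t => ∑ p ∈ primesUpTo (N t), ‖a p t‖ ^ 2) atTop (𝓝 (σ ^ 2))) (z : ℂ) :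
    Tendsto (fun t => charFun (P.map fun x => primeSum a (primesUpTo (N t)) t (ω x)) z) atTop
      (𝓝 (Real.exp (-(σ ^ 2 * ‖z‖ ^ 2 / 4)) : ℂ)) := by
  set Q : ℝ → ℝ := fun t => ∑ p ∈ primesUpTo (N t), ‖a p t‖ ^ 2 with hQdef
  set M : ℝ → ℕ := fun t => max 1 (N t) with hMdef
  have hexp : Tendsto (fun t => ((Real.exp (-(Q t * ‖z‖ ^ 2 / 4)) : ℝ) : ℂ)) atTop
      (𝓝 (Real.exp (-(σ ^ 2 * ‖z‖ ^ 2 / 4)) : ℂ)) :=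
    (Complex.continuous_ofReal.tendsto _).comp ((Real.continuous_exp.tendsto _).comp
      (((hQ.mul_const _).div_const _).neg))
  suffices h : Tendsto (fun t => charFun (P.map fun x => primeSum a (primesUpTo (N t)) t (ω x)) z -
      ((Real.exp (-(Q t * ‖z‖ ^ 2 / 4)) : ℝ) : ℂ)) atTop (𝓝 0) by
    simpa using h.add hexp
  rw [tendsto_zero_iff_norm_tendsto_zero]
  refine tendsto_order.2 ⟨fun c hc => Eventually.of_forall fun t => hc.trans_le (norm_nonneg _),
    fun ε hε => ?_⟩
  -- Order of limits: the Taylor order is fixed first, in terms of `ε`, and only then does `t` tend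
  -- to infinity.
  obtain ⟨j, hj⟩ : ∃ j : ℕ, 2 * (2 * Real.exp (2 * (σ ^ 2 * ‖z‖ ^ 2)) / 2 ^ (2 * j)) < ε := by
    have h1 : Tendsto (fun j : ℕ => 4 * Real.exp (2 * (σ ^ 2 * ‖z‖ ^ 2)) * (1 / 4 : ℝ) ^ j) atTop
        (𝓝 (4 * Real.exp (2 * (σ ^ 2 * ‖z‖ ^ 2)) * 0)) :=
      (tendsto_pow_atTop_nhds_zero_of_lt_one (by norm_num) (by norm_num)).const_mul _
    rw [mul_zero] at h1
    obtain ⟨j, hj⟩ := (h1.eventually (gt_mem_nhds hε)).exists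
    refine ⟨j, lt_of_eq_of_lt ?_ hj⟩
    rw [pow_mul, one_div_pow]
    norm_num
    ring
  set K := 2 * j with hK
  -- The choice `B = (1 + 2‖z‖) M` works once `A t < 1`, as there are at most `2 M` primes. Then `B
  -- ^ K M ^ K / t` is a constant times `M ^ (2K) / t`, which vanishes in the limit.
  set g : ℝ → ℝ := fun t => (K + 1) * (((1 + 2 * ‖z‖) * (M t : ℝ)) ^ K * (2 * (M t : ℝ) ^ K / t)) +
    2 * (2 * Real.exp (2 * (Q t * ‖z‖ ^ 2)) / 2 ^ K) + 2 * (A t * ‖z‖) * (Q t * ‖z‖ ^ 2) with hg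
  have hgt : Tendsto g atTop (𝓝 ((K + 1) * ((1 + 2 * ‖z‖) ^ K * 2 * 0) +
      2 * (2 * Real.exp (2 * (σ ^ 2 * ‖z‖ ^ 2)) / 2 ^ K) + 2 * (0 * ‖z‖) * (σ ^ 2 * ‖z‖ ^ 2))) := by
    have hQz := hQ.mul_const (‖z‖ ^ 2)
    refine Tendsto.add (Tendsto.add ?_ ?_) (((hA.mul_const _).const_mul _).mul hQz)
    · refine Tendsto.const_mul _ (((hN (K + K)).const_mul ((1 + 2 * ‖z‖) ^ K * 2)).congr fun t => ?_)
      rw [mul_pow, pow_add]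
      ring
    · exact ((((Real.continuous_exp.tendsto _).comp (hQz.const_mul 2)).const_mul 2).div_const
        _).const_mul 2
  have hlt : (K + 1) * ((1 + 2 * ‖z‖) ^ K * 2 * 0) +
      2 * (2 * Real.exp (2 * (σ ^ 2 * ‖z‖ ^ 2)) / 2 ^ K) +
        2 * (0 * ‖z‖) * (σ ^ 2 * ‖z‖ ^ 2) < ε := by
    simpa using hj
  have hη : ∀ᶠ t in atTop, A t * ‖z‖ < 1 / 2 := by
    have := hA.mul_const ‖z‖
    rw [zero_mul] at this
    exact this.eventually (gt_mem_nhds (by norm_num))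
  filter_upwards [hgt.eventually (gt_mem_nhds hlt), haA, hη, eventually_gt_atTop 0,
    hA.eventually (gt_mem_nhds one_pos)] with t h1 h2 h3 ht h4
  refine lt_of_le_of_lt ?_ h1
  have hM1 : (1 : ℝ) ≤ M t := by exact_mod_cast le_max_left 1 (N t)
  refine norm_charFun_map_primeSum_sub_le hω a (primesUpTo (N t)) ht z (le_max_left 1 (N t))
    (fun p hp => (mem_primesUpTo.mp hp).trans (le_max_right _ _)) (even_two_mul j) h3.le
    (fun p => mul_le_mul_of_nonneg_right (h2 p) (norm_nonneg z)) ?_ ?_ rfl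
  · nlinarith [norm_nonneg z]
  · calc ∑ p ∈ primesUpTo (N t), ‖a p t‖ * ‖z‖ ≤ ∑ _p ∈ primesUpTo (N t), ‖z‖ := by
          refine Finset.sum_le_sum fun p _ => ?_
          nlinarith [h2 p, norm_nonneg z]
      _ = (primesUpTo (N t)).card * ‖z‖ := by simp
      _ ≤ (2 * (M t : ℝ)) * ‖z‖ := by
          gcongr
          have h5 : (primesUpTo (N t)).card ≤ 2 * M t := by
            have := card_primesUpTo_le (N t)
            simp only [hMdef]
            omega
          exact_mod_cast h5
      _ ≤ _ := by nlinarith [norm_nonneg z]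

/-- Lévy's theorem along sequences suffices, because `atTop` on `ℝ` is countably generated. -/
theorem tendstoInDistribution_of_tendsto_charFun {Ω Ω' : Type*} [MeasurableSpace Ω]
    [MeasurableSpace Ω'] {P : Measure Ω} [IsProbabilityMeasure P] {P' : Measure Ω'}
    [IsProbabilityMeasure P'] {X : ℝ → Ω → ℂ} {Z : Ω' → ℂ} (hX : ∀ t, AEMeasurable (X t) P)
    (hZ : AEMeasurable Z P')
    (h : ∀ z, Tendsto (fun t => charFun (P.map (X t)) z) atTop (𝓝 (charFun (P'.map Z) z))) :
    TendstoInDistribution X atTop Z (fun _ => P) P' where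
  forall_aemeasurable := hX
  aemeasurable_limit := hZ
  tendsto := by
    refine tendsto_of_seq_tendsto fun u hu => ?_
    exact ProbabilityMeasure.tendsto_of_tendsto_charFun fun z => (h z).comp hu

theorem IsStdComplexNormal.aemeasurable {Ω : Type*} [MeasurableSpace Ω] {P : Measure Ω}
    {Y : Ω → ℂ} (hY : IsStdComplexNormal Y P) : AEMeasurable Y P := by
  obtain ⟨N₁, N₂, h1, h2, -, hYeq⟩ := hY
  rw [show Y = _ from funext hYeq]
  have := h1.aemeasurable
  have := h2.aemeasurable
  fun_prop

/-- The mean-square bound holds uniformly for the blocks `m < p ≤ N`, and the `L²` norm is lower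
semicontinuous under convergence in measure. Hence any limit in probability will do. -/
theorem eLpNorm_sub_primeSum_sq_le {Ω : Type*} [MeasurableSpace Ω] {P : Measure Ω}
    [IsProbabilityMeasure P] {ω : Ω → ℝ} (hω : pdf.IsUniform ω (Set.Ioo (0 : ℝ) 1) P)
    (a : Nat.Primes → ℝ → ℂ) {t : ℝ} (ht : 2 ≤ t) {m : ℝ} (hm : 0 < m) {X : Ω → ℂ}
    (hX : TendstoInMeasure P (fun (N : ℕ) (x : Ω) => primeSum a (primesUpTo N) t (ω x)) atTop X) :
    eLpNorm (fun x => X x - primeSum a (primesUpTo ⌊m⌋₊) t (ω x)) 2 P ^ 2 ≤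
      ENNReal.ofReal (Real.exp 2 * √Real.pi * 4) * ∑' p : {p : Nat.Primes // m < ((p : ℕ) : ℝ)},
        ‖a p.1 t‖ₑ ^ 2 * ENNReal.ofReal (1 + ((p.1 : ℕ) : ℝ) / t) := by
  classical
  set D : ℝ≥0∞ := ENNReal.ofReal (Real.exp 2 * √Real.pi * 4) *
    ∑' p : {p : Nat.Primes // m < ((p : ℕ) : ℝ)},
      ‖a p.1 t‖ₑ ^ 2 * ENNReal.ofReal (1 + ((p.1 : ℕ) : ℝ) / t) with hD
  have hmeas : ∀ s, AEStronglyMeasurable (fun x => primeSum a s t (ω x)) P :=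
    fun s => (memLp_primeSum hω a s t).aestronglyMeasurable
  have hroot : ∀ x : ℝ≥0∞, x ^ 2 ≤ D ↔ x ≤ D ^ (1 / 2 : ℝ) := by
    intro x
    rw [one_div, ENNReal.le_rpow_inv_iff (by norm_num), ENNReal.rpow_two]
  rw [hroot]
  refine eLpNorm_le_of_tendstoInMeasure (u := atTop) (f := fun (N : ℕ) (x : Ω) =>
    primeSum a (primesUpTo N) t (ω x) - primeSum a (primesUpTo ⌊m⌋₊) t (ω x)) ?_ ?_
    fun N => (hmeas _).sub (hmeas _)
  · filter_upwards [eventually_ge_atTop ⌊m⌋₊] with N hN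
    rw [← hroot]
    have hsub : primesUpTo ⌊m⌋₊ ⊆ primesUpTo N := fun p hp =>
      mem_primesUpTo.mpr ((mem_primesUpTo.mp hp).trans hN)
    have h1 : ∀ x, primeSum a (primesUpTo N) t (ω x) - primeSum a (primesUpTo ⌊m⌋₊) t (ω x) =
        primeSum a (primesUpTo N \ primesUpTo ⌊m⌋₊) t (ω x) := by
      intro x
      rw [sub_eq_iff_eq_add]
      exact (Finset.sum_sdiff hsub).symm
    simp_rw [h1]
    refine (eLpNorm_primeSum_sq_le hω a _ ht).trans ?_
    rw [hD]
    gcongr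
    refine sum_le_tsum_subtype (q := fun p : Nat.Primes => m < ((p : ℕ) : ℝ))
      (fun p => ‖a p t‖ₑ ^ 2 * ENNReal.ofReal (1 + ((p : ℕ) : ℝ) / t)) _ fun p hp => ?_
    by_contra hpm
    exact (Finset.mem_sdiff.mp hp).2 ((mem_primesUpTo_floor hm).mpr hpm)
  · intro ε hε
    simpa only [edist_sub_right] using hX ε hε

theorem proposition3p1
    {Ω : Type*} [MeasurableSpace Ω] (P : Measure Ω) [IsProbabilityMeasure P]
    {Ω' : Type*} [MeasurableSpace Ω'] (P' : Measure Ω') [IsProbabilityMeasure P']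
    -- `ω` is uniform on `(0, 1)` and `Y` is a standard complex normal variable
    (ω : Ω → ℝ) (hω : pdf.IsUniform ω (Set.Ioo (0 : ℝ) 1) P)
    (Y : Ω' → ℂ) (hY : IsStdComplexNormal Y P')
    -- Suprema and sums in the hypotheses are taken in `[0, ∞]`, so that their convergence to a
    -- finite limit includes their finiteness for all large `t`.
    (a : Nat.Primes → ℝ → ℂ) (σ : ℝ)
    (hsup : Tendsto (fun t : ℝ => ⨆ p : Nat.Primes, ‖a p t‖ₑ) atTop (𝓝 0))
    (hsum : Tendsto (fun t : ℝ => ∑' p : Nat.Primes, ‖a p t‖ₑ ^ 2) atTop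
      (𝓝 (ENNReal.ofReal (σ ^ 2))))
    (m : ℝ → ℝ) (hmpos : ∀ᶠ t in atTop, 0 < m t)
    (hm : Tendsto (fun t : ℝ => Real.log (m t) / Real.log t) atTop (𝓝 0))
    (htail : Tendsto (fun t : ℝ => ∑' p : {p : Nat.Primes // m t < ((p : ℕ) : ℝ)},
        ‖a p.1 t‖ₑ ^ 2 * ENNReal.ofReal (1 + ((p.1 : ℕ) : ℝ) / t)) atTop (𝓝 0)) :
    -- for all large `t` the sum over all primes converges, unconditionally, in `L²`
    (∀ᶠ t in atTop, ∃ X : Ω → ℂ, MemLp X 2 P ∧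
      Tendsto (fun s : Finset Nat.Primes => eLpNorm (fun x => primeSum a s t (ω x) - X x) 2 P)
        atTop (𝓝 0)) ∧
    -- and, in whichever mode that implies convergence in probability of the partial sums over
    -- `p ≤ N` it is understood, it converges in law to `σ Y`
    (∀ X : ℝ → Ω → ℂ, (∀ t, AEMeasurable (X t) P) →
      (∀ᶠ t in atTop, TendstoInMeasure P
        (fun (N : ℕ) (x : Ω) => primeSum a (primesUpTo N) t (ω x)) atTop (X t)) →
      TendstoInDistribution X atTop (fun y => (σ : ℂ) * Y y) (fun _ => P) P') := by
  have htail_fin := htail.eventually (gt_mem_nhds ENNReal.zero_lt_top)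
  have hsup_fin := hsup.eventually (gt_mem_nhds ENNReal.zero_lt_top)
  refine ⟨?_, fun X hX hlim => ?_⟩
  · filter_upwards [htail_fin, hmpos, eventually_ge_atTop 2] with t h1 h2 ht
    refine exists_tendsto_eLpNorm_primeSum_sub hω a ht (ne_top_of_le_ne_top ?_
      (tsum_le_sum_add_tsum_subtype (q := fun p : Nat.Primes => m t < ((p : ℕ) : ℝ))
        (fun p => ‖a p t‖ₑ ^ 2 * ENNReal.ofReal (1 + ((p : ℕ) : ℝ) / t)) (primesUpTo ⌊m t⌋₊)
        fun p => mem_primesUpTo_floor h2))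
    refine ENNReal.add_ne_top.mpr ⟨ENNReal.sum_ne_top.mpr fun p _ => ?_, h1.ne⟩
    exact ENNReal.mul_ne_top (ENNReal.pow_ne_top enorm_ne_top) ENNReal.ofReal_ne_top
  set S : ℝ → Ω → ℂ := fun t x => primeSum a (primesUpTo ⌊m t⌋₊) t (ω x) with hS
  have hSm : ∀ t, AEMeasurable (S t) P :=
    fun t => (memLp_primeSum hω a _ t).aestronglyMeasurable.aemeasurable
  have hhead : TendstoInDistribution S atTop (fun y => (σ : ℂ) * Y y) (fun _ => P) P' := by
    refine tendstoInDistribution_of_tendsto_charFun hSm (hY.aemeasurable.const_mul _) fun z => ?_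
    rw [charFun_map_mul_stdComplexNormal hY]
    refine tendsto_charFun_map_primeSum hω a (N := fun t => ⌊m t⌋₊)
      (A := fun t => (⨆ p : Nat.Primes, ‖a p t‖ₑ).toReal)
      (tendsto_max_one_floor_pow_div hmpos hm) ?_ ?_ ?_ z
    · have h := (ENNReal.tendsto_toReal ENNReal.zero_ne_top).comp hsup
      rwa [ENNReal.toReal_zero] at h
    · filter_upwards [hsup_fin] with t ht p
      have := ENNReal.toReal_mono ht.ne (le_iSup (fun p : Nat.Primes => ‖a p t‖ₑ) p)
      rwa [toReal_enorm] at this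
    · have hq : Tendsto (fun t => ∑ p ∈ primesUpTo ⌊m t⌋₊, ‖a p t‖ₑ ^ 2) atTop
          (𝓝 (ENNReal.ofReal (σ ^ 2))) := by
        -- Since `1 + p/t ≥ 1`, the weighted tail dominates the plain one, so the head is squeezed
        -- between the total minus the weighted tail and the total.
        have hlow := ENNReal.Tendsto.sub hsum htail (Or.inr ENNReal.zero_ne_top)
        rw [tsub_zero] at hlow
        refine tendsto_of_tendsto_of_tendsto_of_le_of_le' hlow hsum ?_
          (Eventually.of_forall fun t => ENNReal.sum_le_tsum _)
        filter_upwards [hmpos, eventually_gt_atTop 0] with t h2 ht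
        rw [tsub_le_iff_right]
        refine (tsum_le_sum_add_tsum_subtype (q := fun p : Nat.Primes => m t < ((p : ℕ) : ℝ))
          (fun p => ‖a p t‖ₑ ^ 2) _ fun p => mem_primesUpTo_floor h2).trans ?_
        gcongr with p
        refine le_mul_of_one_le_right' (ENNReal.one_le_ofReal.mpr ?_)
        have : 0 ≤ ((p.1 : ℕ) : ℝ) / t := by positivity
        linarith
      have h := (ENNReal.tendsto_toReal ENNReal.ofReal_ne_top).comp hq
      rw [ENNReal.toReal_ofReal (sq_nonneg σ)] at h
      refine h.congr fun t => ?_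
      rw [Function.comp_apply, ENNReal.toReal_sum fun p _ => ENNReal.pow_ne_top enorm_ne_top]
      simp
  -- Slutsky: it remains to see that `X t - S t` tends to `0` in measure, which its `L²` norm shows.
  refine tendstoInDistribution_of_tendstoInMeasure_sub X _ hhead ?_ hX
  refine tendstoInMeasure_of_tendsto_eLpNorm (p := 2) two_ne_zero
    (fun t => ((hX t).sub (hSm t)).aestronglyMeasurable) aestronglyMeasurable_zero ?_
  have hD : Tendsto (fun t : ℝ => (ENNReal.ofReal (Real.exp 2 * √Real.pi * 4) *
      ∑' p : {p : Nat.Primes // m t < ((p : ℕ) : ℝ)},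
        ‖a p.1 t‖ₑ ^ 2 * ENNReal.ofReal (1 + ((p.1 : ℕ) : ℝ) / t)) ^ (1 / 2 : ℝ)) atTop (𝓝 0) := by
    have h1 := ENNReal.Tendsto.const_mul (a := ENNReal.ofReal (Real.exp 2 * √Real.pi * 4)) htail
      (Or.inr ENNReal.ofReal_ne_top)
    have h2 := h1.ennrpow_const (1 / 2 : ℝ)
    simpa using h2
  refine tendsto_of_tendsto_of_tendsto_of_le_of_le' tendsto_const_nhds hD
    (Eventually.of_forall fun t => zero_le) ?_
  filter_upwards [hlim, hmpos, eventually_ge_atTop 2] with t h1 h2 ht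
  rw [one_div, ENNReal.le_rpow_inv_iff (by norm_num), ENNReal.rpow_two, sub_zero]
  exact eLpNorm_sub_primeSum_sq_le hω a ht h2 h1
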